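/- Let $n\ge 1$. A convex body in $\mathbb R^n$ is a compact convex set with nonempty interior. For a convex body $K$ and $z\in\operatorname{int}K$ put $K^z=z+\{y:\langle x-z,y\rangle\le 1\ \text{for all }x\in K\}$, and define the volume product $$\mathcal P(K)=\min_{z\in \operatorname{int}K}\operatorname{vol}(K)\operatorname{vol}(K^z).$$ Let $\operatorname{Cov}(K)$ be the matrix with entries $\frac{\int_K x_ix_j\,dx}{\operatorname{vol}(K)}-\frac{\int_K x_i\,dx}{\operatorname{vol}(K)}\frac{\int_K x_j\,dx}{\operatorname{vol}(K)}$, and let the isotropic constant $L_K\geq 0$ be given by $L_K^{2n}=\det(\operatorname{Cov}(K))\operatorname{vol}(K)^{-2}$. Let $\Delta_n=\{x\in\mathbb R^n: x_i\ge 0 \text{ for all } i,\ \sum_i x_i\le 1\}$. A simplex is the convex hull of $n+1$ affinely independent points of $\mathbb R^n$. Then $$L_{\Delta_n}=\frac{(n!)^{1/n}}{(n+1)^{\frac{n+1}{2n}}\sqrt{n+2}},\qquad \mathcal P(\Delta_n)=\frac{(n+1)^{n+1}}{(n!)^2},$$ and $\mathcal P(K)=\mathcal P(\Delta_n)$ for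 every simplex $K$. Theorem (Klartag). If the strong slicing conjecture holds in $\mathbb R^n$, i.e. $L_K\le L_{\Delta_n}$ for every convex body $K\subset\mathbb R^n$, then Mahler's conjecture holds in $\mathbb R^n$, i.e. $\mathcal P(K)\ge\mathcal P(\Delta_n)$ for every convex body $K\subset\mathbb R^n$. If, moreover, simplices are the only convex bodies in $\mathbb R^n$ with $L_K=L_{\Delta_n}$, then simplices are the only convex bodies in $\mathbb R^n$ with $\mathcal P(K)=\mathcal P(\Delta_n)$. -/

import Mathlib

open MeasureTheory

noncomputable section

namespace SlicingMahler

/-- Euclidean space of dimension `n`. -/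
abbrev E (n : ℕ) : Type := EuclideanSpace ℝ (Fin n)

/-- A convex body: a compact convex set with nonempty interior. -/
structure IsConvexBody {n : ℕ} (K : Set (E n)) : Prop where
  convex : Convex ℝ K
  isCompact : IsCompact K
  nonempty_interior : (interior K).Nonempty

/-- The polar set of `K`, the set of all `y` with `⟪x, y⟫ ≤ 1` for every `x ∈ K`. -/
def polar {n : ℕ} (K : Set (E n)) : Set (E n) :=
  {y | ∀ x ∈ K, inner ℝ x y ≤ 1}

/-- The polar of `K` with respect to `z`, that is, the set `(K - z)^* + z`. -/
def polarAt {n : ℕ} (K : Set (E n)) (z : E n) : Set (E n) :=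
  {y | y - z ∈ polar ((fun x => x - z) '' K)}

/-- The volume product of `K`: the least value of `vol(K) vol(K^z)` over `z` in the interior of `K`
(for a convex body it is attained exactly at the Santaló point). -/
def volumeProduct {n : ℕ} (K : Set (E n)) : ℝ :=
  ⨅ z : interior K, volume.real K * volume.real (polarAt K (z : E n))

/-- The covariance matrix of the uniform probability measure on `K`. -/
def covMatrix {n : ℕ} (K : Set (E n)) : Matrix (Fin n) (Fin n) ℝ :=
  Matrix.of fun i j =>
    (∫ x in K, x i * x j) / volume.real K -
      ((∫ x in K, x i) / volume.real K) * ((∫ x in K, x j) / volume.real K)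

/-- The isotropic constant: the nonnegative number with `L_K ^ (2n) = det Cov(K) / vol(K) ^ 2`. -/
def isotropicConstant {n : ℕ} (K : Set (E n)) : ℝ :=
  ((covMatrix K).det / volume.real K ^ 2) ^ (1 / (2 * (n : ℝ)))

/-- A (nondegenerate) simplex: the convex hull of `n + 1` affinely independent points. -/
def IsSimplex {n : ℕ} (K : Set (E n)) : Prop :=
  ∃ p : Fin (n + 1) → E n, AffineIndependent ℝ p ∧ K = convexHull ℝ (Set.range p)

/-- The model simplex, with vertices `0` and the standard basis vectors. -/
def simplex (n : ℕ) : Set (E n) :=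
  {x | (∀ i, 0 ≤ x i) ∧ ∑ i, x i ≤ 1}

/-- The strong slicing conjecture in dimension `n`: `L_K ≤ L_{Δ_n}` for all convex bodies. -/
def StrongSlicing (n : ℕ) : Prop :=
  ∀ K : Set (E n), IsConvexBody K → isotropicConstant K ≤ isotropicConstant (simplex n)

end SlicingMahler

end

namespace SlicingMahler

open Topology TopologicalSpace Metric

variable {n : ℕ}

/-! ### Polars -/

/-! The pair (body, base point) minimizing vol(K) vol(K^z) is treated as a critical point of a
variational problem. The product is affine invariant, jointly lower semicontinuous, and infinite
when the base point leaves the interior. Since every body has an affine copy squeezed between the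
model simplex and a fixed ball, compactness gives a global minimizer
(`exists_forall_volumeProductAt_le`), which may be translated so that z = 0.

Perturb K to the polar of K° + ta, based at -tb. Both volumes that arise are those of projective
images, and the map x ↦ x / (1 + ⟨a,x⟩) has Jacobian (1 + ⟨a,x⟩)^(-(n+1)). Minimality thus bounds
vol(K) vol(K°) by the product of ∫_K (1 + t⟨a,x⟩)^(-(n+1)) dx and ∫_{K°} (1 + t⟨b,y⟩ +
t²⟨b,a⟩)^(-(n+1)) dy (`perturbed_volumeProductAt_le`). The first-order terms put both barycentres at
0. The second-order terms give 2⟨a,b⟩ ≤ (n+2)(⟨a, Cov(K) a⟩ + ⟨b, Cov(K°) b⟩) for all a, b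
(`optimality_conditions`), whence det Cov(K) · det Cov(K°) ≥ (n+2)^(-2n).

In terms of isotropic constants this reads L_K^(2n) L_{K°}^(2n) P² ≥ (n+2)^(-2n), with P the minimal
product. Explicit computation on the simplex gives L_Δ^(2n) P(Δ) = (n+2)^(-n). So if both isotropic
constants are at most L_Δ, then P ≥ P(Δ), and P = P(Δ) forces L_K = L_Δ
(`StrongSlicing.le_of_isMin`). -/

theorem mem_polarAt {K : Set (E n)} {z y : E n} :
    y ∈ polarAt K z ↔ ∀ x ∈ K, inner ℝ (x - z) (y - z) ≤ 1 := by
  simp [polarAt, polar]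

theorem convex_polar (K : Set (E n)) : Convex ℝ (polar K) := by
  intro y hy w hw a b ha hb hab x hx
  rw [inner_add_right, inner_smul_right, inner_smul_right]
  nlinarith [hy x hx, hw x hx]

theorem isClosed_polar (K : Set (E n)) : IsClosed (polar K) := by
  have : polar K = ⋂ x ∈ K, {y | inner ℝ x y ≤ 1} := by ext; simp [polar]
  rw [this]
  exact isClosed_biInter fun x _ => isClosed_le (by fun_prop) continuous_const

theorem polarAt_eq_preimage (K : Set (E n)) (z : E n) :
    polarAt K z = (fun y => y + -z) ⁻¹' polar ((fun x => x - z) '' K) := by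
  ext y
  simp [polarAt, sub_eq_add_neg]

theorem volume_polarAt (K : Set (E n)) (z : E n) :
    volume (polarAt K z) = volume (polar ((fun x => x - z) '' K)) := by
  rw [polarAt_eq_preimage, measure_preimage_add_right]

theorem polarAt_zero (K : Set (E n)) : polarAt K 0 = polar K := by
  simp [polarAt]

theorem convex_polarAt (K : Set (E n)) (z : E n) : Convex ℝ (polarAt K z) := by
  rw [polarAt_eq_preimage]
  exact (convex_polar _).translate_preimage_left _

/-- The polar of a bounded set contains a neighbourhood of the origin. -/
theorem polar_mem_nhds {K : Set (E n)} (hK : Bornology.IsBounded K) : polar K ∈ 𝓝 (0 : E n) := by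
  obtain ⟨R, hR, h⟩ := hK.exists_pos_norm_le
  filter_upwards [Metric.ball_mem_nhds (0 : E n) (inv_pos.2 hR)] with y hy x hx
  rw [mem_ball_zero_iff] at hy
  calc inner ℝ x y ≤ ‖x‖ * ‖y‖ := real_inner_le_norm x y
    _ ≤ R * R⁻¹ := by gcongr; exact h x hx
    _ = 1 := mul_inv_cancel₀ hR.ne'

/-- The polar of a neighbourhood of the origin is bounded. -/
theorem isBounded_polar {K : Set (E n)} (hK : K ∈ 𝓝 (0 : E n)) : Bornology.IsBounded (polar K) := by
  obtain ⟨r, hr, h⟩ := Metric.nhds_basis_closedBall.mem_iff.1 hK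
  refine (isBounded_iff_forall_norm_le).2 ⟨r⁻¹, fun y hy => ?_⟩
  rcases eq_or_ne y 0 with rfl | hy0
  · simp [hr.le]
  have hn : 0 < ‖y‖ := norm_pos_iff.2 hy0
  have := hy ((r / ‖y‖) • y) (h (by
    rw [mem_closedBall_zero_iff, norm_smul, Real.norm_eq_abs, abs_of_pos (by positivity)]
    field_simp; exact le_rfl))
  rw [real_inner_smul_left, real_inner_self_eq_norm_sq] at this
  rw [← one_div, le_div_iff₀ hr]
  field_simp at this
  linarith

/-- The bipolar theorem for closed convex sets containing the origin. -/
theorem polar_polar {K : Set (E n)} (hc : Convex ℝ K) (hcl : IsClosed K) (h0 : (0 : E n) ∈ K) :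
    polar (polar K) = K := by
  refine Set.Subset.antisymm (fun x hx => ?_) fun x hx y hy => by
    rw [real_inner_comm]; exact hy x hx
  by_contra hxK
  obtain ⟨f, u, hu, hf⟩ := geometric_hahn_banach_closed_point hc hcl hxK
  obtain ⟨v, rfl⟩ := (InnerProductSpace.toDual ℝ (E n)).surjective f
  simp only [InnerProductSpace.toDual_apply_apply] at hu hf
  have hu0 : 0 < u := by simpa using hu 0 h0
  have hv : u⁻¹ • v ∈ polar K := fun w hw => by
    rw [inner_smul_right, real_inner_comm, inv_mul_le_iff₀ hu0, mul_one]
    exact (hu w hw).le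
  have := hx _ hv
  rw [real_inner_smul_left, inv_mul_le_iff₀ hu0, mul_one] at this
  linarith

theorem IsConvexBody.polar {K : Set (E n)} (hK : IsConvexBody K) (h0 : (0 : E n) ∈ interior K) :
    IsConvexBody (polar K) where
  convex := convex_polar K
  isCompact := isCompact_of_isClosed_isBounded (isClosed_polar K)
    (isBounded_polar (mem_interior_iff_mem_nhds.1 h0))
  nonempty_interior := ⟨0, mem_interior_iff_mem_nhds.2 (polar_mem_nhds hK.isCompact.isBounded)⟩

theorem IsConvexBody.volume_pos {K : Set (E n)} (hK : IsConvexBody K) : 0 < volume K :=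
  (isOpen_interior.measure_pos _ hK.nonempty_interior).trans_le (measure_mono interior_subset)

theorem IsConvexBody.volumeReal_pos {K : Set (E n)} (hK : IsConvexBody K) : 0 < volume.real K :=
  ENNReal.toReal_pos hK.volume_pos.ne' hK.isCompact.measure_lt_top.ne

theorem IsConvexBody.nonempty {K : Set (E n)} (hK : IsConvexBody K) : K.Nonempty :=
  hK.nonempty_interior.mono interior_subset

theorem volume_interior_eq {K : Set (E n)} (hK : Convex ℝ K) : volume (interior K) = volume K := by
  refine le_antisymm (measure_mono interior_subset) ?_
  calc volume K ≤ volume (interior K ∪ frontier K) := by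
        rw [← closure_eq_interior_union_frontier]; exact measure_mono subset_closure
    _ ≤ volume (interior K) + volume (frontier K) := measure_union_le _ _
    _ = volume (interior K) := by rw [hK.addHaar_frontier volume, add_zero]

/-! ### Affine images -/

/-- The image of a set under the affine bijection `x ↦ A x + v`. -/
def affImage (A : E n ≃L[ℝ] E n) (v : E n) (K : Set (E n)) : Set (E n) := (fun x => A x + v) '' K

theorem affImage_eq (A : E n ≃L[ℝ] E n) (v : E n) (K : Set (E n)) :
    affImage A v K = (A.toHomeomorph.trans (Homeomorph.addRight v)) '' K := rfl

theorem interior_affImage (A : E n ≃L[ℝ] E n) (v : E n) (K : Set (E n)) :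
    interior (affImage A v K) = affImage A v (interior K) := by
  rw [affImage_eq, affImage_eq, Homeomorph.image_interior]

theorem convex_affImage (A : E n ≃L[ℝ] E n) (v : E n) {K : Set (E n)} (hK : Convex ℝ K) :
    Convex ℝ (affImage A v K) := by
  have h := (hK.linear_image (A : E n →ₗ[ℝ] E n)).translate v
  rw [Set.image_image] at h
  have e : affImage A v K = (fun x => v + (A : E n →ₗ[ℝ] E n) x) '' K := by
    unfold affImage
    congr 1
    ext1 x
    exact add_comm _ _
  rw [e]
  exact h

theorem IsConvexBody.affImage {K : Set (E n)} (hK : IsConvexBody K) (A : E n ≃L[ℝ] E n) (v : E n) :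
    IsConvexBody (affImage A v K) where
  convex := convex_affImage A v hK.convex
  isCompact := hK.isCompact.image (by fun_prop)
  nonempty_interior := by
    rw [interior_affImage]
    exact hK.nonempty_interior.image _

theorem volume_affImage (A : E n ≃L[ℝ] E n) (v : E n) (K : Set (E n)) :
    volume (affImage A v K) =
      ENNReal.ofReal |LinearMap.det (A : E n →ₗ[ℝ] E n)| * volume K := by
  have : affImage A v K = (fun x => x + v) '' ((A : E n →ₗ[ℝ] E n) '' K) := by
    rw [Set.image_image]; rfl
  rw [this, Set.image_add_right, measure_preimage_add_right, Measure.addHaar_image_linearMap]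

theorem det_adjoint (A : E n →L[ℝ] E n) :
    LinearMap.det (ContinuousLinearMap.adjoint A : E n →ₗ[ℝ] E n) =
      LinearMap.det (A : E n →ₗ[ℝ] E n) := by
  have h : (ContinuousLinearMap.adjoint A : E n →ₗ[ℝ] E n) =
      LinearMap.adjoint (A : E n →ₗ[ℝ] E n) := rfl
  rw [h, ← LinearMap.det_toMatrix (EuclideanSpace.basisFun (Fin n) ℝ).toBasis,
    LinearMap.toMatrix_adjoint, Matrix.det_conjTranspose, LinearMap.det_toMatrix]
  simp

/-- Polarity turns `A` into the inverse of its adjoint, while moving the base point along with the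
body absorbs the translation. -/
theorem volume_polarAt_affImage (A : E n ≃L[ℝ] E n) (v : E n) (K : Set (E n)) (z : E n) :
    volume (polarAt (affImage A v K) (A z + v)) =
      ENNReal.ofReal |(LinearMap.det (A : E n →ₗ[ℝ] E n))⁻¹| * volume (polarAt K z) := by
  have hA : LinearMap.det (A : E n →ₗ[ℝ] E n) ≠ 0 := (LinearEquiv.isUnit_det' A.toLinearEquiv).ne_zero
  have h : polar ((fun x => x - (A z + v)) '' affImage A v K) =
      (ContinuousLinearMap.adjoint (A : E n →L[ℝ] E n) : E n →ₗ[ℝ] E n) ⁻¹'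
        polar ((fun x => x - z) '' K) := by
    ext y
    simp [polar, affImage, ContinuousLinearMap.adjoint_inner_right]
  rw [volume_polarAt, volume_polarAt, h, Measure.addHaar_preimage_linearMap _ (by
    rw [det_adjoint]; exact hA), det_adjoint]
  rfl

/-- The (extended) volume product of `K` with respect to the point `z`. -/
noncomputable def volumeProductAt (K : Set (E n)) (z : E n) : ENNReal :=
  volume K * volume (polarAt K z)

theorem volumeProductAt_affImage (A : E n ≃L[ℝ] E n) (v : E n) (K : Set (E n)) (z : E n) :
    volumeProductAt (affImage A v K) (A z + v) = volumeProductAt K z := by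
  have hA : LinearMap.det (A : E n →ₗ[ℝ] E n) ≠ 0 := (LinearEquiv.isUnit_det' A.toLinearEquiv).ne_zero
  rw [volumeProductAt, volumeProductAt, volume_affImage, volume_polarAt_affImage,
    mul_mul_mul_comm, ← ENNReal.ofReal_mul (abs_nonneg _), ← abs_mul, mul_inv_cancel₀ hA]
  simp

theorem image_sub_mem_nhds {K : Set (E n)} {z : E n} (hz : z ∈ interior K) :
    (fun x => x - z) '' K ∈ 𝓝 (0 : E n) := by
  have := (Homeomorph.subRight z).isOpenMap.image_mem_nhds (mem_interior_iff_mem_nhds.1 hz)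
  simpa using this

theorem volume_polarAt_lt_top {K : Set (E n)} {z : E n} (hz : z ∈ interior K) :
    volume (polarAt K z) < ⊤ := by
  rw [volume_polarAt]
  exact (isBounded_polar (image_sub_mem_nhds hz)).measure_lt_top

theorem volumeProductAt_lt_top {K : Set (E n)} (hK : IsConvexBody K) {z : E n}
    (hz : z ∈ interior K) : volumeProductAt K z < ⊤ :=
  ENNReal.mul_lt_top hK.isCompact.measure_lt_top (volume_polarAt_lt_top hz)

theorem volumeProduct_eq_iInf (K : Set (E n)) :
    volumeProduct K = ⨅ z : interior K, (volumeProductAt K z).toReal := by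
  simp [volumeProduct, volumeProductAt, Measure.real, ENNReal.toReal_mul]

theorem volumeProduct_le {K : Set (E n)} {z : E n} (hz : z ∈ interior K) :
    volumeProduct K ≤ (volumeProductAt K z).toReal := by
  rw [volumeProduct_eq_iInf]
  exact ciInf_le (f := fun z : interior K => (volumeProductAt K z).toReal)
    ⟨0, by rintro _ ⟨z, rfl⟩; exact ENNReal.toReal_nonneg⟩ ⟨z, hz⟩

theorem volumeProduct_affImage (A : E n ≃L[ℝ] E n) (v : E n) (K : Set (E n)) :
    volumeProduct (affImage A v K) = volumeProduct K := by
  rw [volumeProduct_eq_iInf, volumeProduct_eq_iInf]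
  refine (Equiv.iInf_congr (((A.toHomeomorph.trans (Homeomorph.addRight v)).toEquiv.image
    (interior K)).trans (Equiv.setCongr (by rw [interior_affImage]; rfl))) fun z => ?_).symm
  exact congrArg _ (volumeProductAt_affImage A v K z)

/-! ### Existence of minimizers of the volume product -/

/-- A functional `u` separating `z` from the interior is a recession direction of the polar, which
also contains a ball around 0 and hence a half-infinite tube. This lets minimization run over
compact sets of base points, where bad points exclude themselves. -/
theorem volumeProductAt_eq_top {K : Set (E n)} (hK : IsConvexBody K) {z : E n}
    (hz : z ∉ interior K) : volumeProductAt K z = ⊤ := by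
  obtain ⟨f, hf⟩ := geometric_hahn_banach_open_point hK.convex.interior isOpen_interior hz
  obtain ⟨u, rfl⟩ := (InnerProductSpace.toDual ℝ (E n)).surjective f
  simp only [InnerProductSpace.toDual_apply_apply] at hf
  have hu : u ≠ 0 := by
    rintro rfl
    obtain ⟨a, ha⟩ := hK.nonempty_interior
    simpa using hf a ha
  have hle : ∀ x ∈ K, inner ℝ u x ≤ inner ℝ u z := fun x hx => by
    have h1 : x ∈ closure (interior K) := by
      rw [hK.convex.closure_interior_eq_closure_of_nonempty_interior hK.nonempty_interior]
      exact subset_closure hx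
    refine closure_minimal (fun a ha => (hf a ha).le)
      (isClosed_le (by fun_prop) continuous_const : IsClosed {x | inner ℝ u x ≤ inner ℝ u z}) h1
  set Q := polar ((fun x => x - z) '' K) with hQ
  have hbd : Bornology.IsBounded ((fun x => x - z) '' K) :=
    (hK.isCompact.image (by fun_prop)).isBounded
  obtain ⟨ε, hε, hball⟩ := Metric.mem_nhds_iff.1 (polar_mem_nhds hbd)
  have hray : ∀ y ∈ Q, ∀ t : ℝ, 0 ≤ t → y + t • u ∈ Q := by
    rintro y hy t ht _ ⟨x, hx, rfl⟩
    have h1 := hy _ ⟨x, hx, rfl⟩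
    have h2 := hle x hx
    have h3 : inner ℝ (x - z) u ≤ 0 := by
      rw [real_inner_comm, inner_sub_right]; linarith
    simp only [inner_add_right, inner_smul_right] at h1 ⊢
    nlinarith
  have hun : 0 < ‖u‖ := norm_pos_iff.2 hu
  -- Centres spaced `2 * ε` apart along the ray, so the balls of radius `ε` are disjoint.
  let c : ℕ → E n := fun k => (k * (2 * ε / ‖u‖)) • u
  have hsub : (⋃ k, ball (c k) ε) ⊆ Q := by
    refine Set.iUnion_subset fun k y hy => ?_
    have := hray (y - c k) (hball (by simpa [dist_eq_norm] using hy)) (k * (2 * ε / ‖u‖))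
      (by positivity)
    simpa [c] using this
  have hdisj : Pairwise (Function.onFun Disjoint fun k => ball (c k) ε) := by
    intro i j hij
    refine ball_disjoint_ball ?_
    have h1 : (1 : ℝ) ≤ |(i : ℝ) - j| := by
      have : (1 : ℤ) ≤ |(i : ℤ) - j| := Int.one_le_abs (by omega)
      exact_mod_cast this
    rw [dist_eq_norm, ← sub_smul, ← sub_mul, norm_smul, norm_mul, Real.norm_eq_abs,
      Real.norm_eq_abs, abs_of_pos (show 0 < 2 * ε / ‖u‖ by positivity), mul_assoc,
      div_mul_cancel₀ _ hun.ne']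
    nlinarith
  have htop : volume Q = ⊤ := by
    refine top_le_iff.1 ((measure_mono hsub).trans' ?_)
    rw [measure_iUnion hdisj fun _ => measurableSet_ball]
    simp_rw [Measure.addHaar_ball_center]
    rw [ENNReal.tsum_const_eq_top_of_ne_zero (measure_ball_pos _ _ hε).ne']
  rw [volumeProductAt, volume_polarAt, htop, ENNReal.mul_top hK.volume_pos.ne']

/-- A compact subset of the interior of a convex body is contained in all nearby convex bodies. -/
theorem eventually_subset_of_subset_interior {K : NonemptyCompacts (E n)} {C : Set (E n)}
    (hC : IsCompact C) (hCK : C ⊆ interior (K : Set (E n))) :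
    ∀ᶠ L : NonemptyCompacts (E n) in 𝓝 K, Convex ℝ (L : Set (E n)) → C ⊆ L := by
  obtain ⟨δ, hδ, hsub⟩ := hC.exists_thickening_subset_open isOpen_interior hCK
  filter_upwards [Metric.ball_mem_nhds K (half_pos hδ)] with L hL hconv x hx
  by_contra hxL
  obtain ⟨p, hp, hpx⟩ := exists_norm_eq_iInf_of_complete_convex L.nonempty
    L.isCompact.isComplete hconv x
  have hp' := (norm_eq_iInf_iff_real_inner_le_zero hconv hp).1 hpx
  have hxp : 0 < ‖x - p‖ := norm_pos_iff.2 (sub_ne_zero.2 fun h => hxL (h ▸ hp))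
  -- Push `x` by `δ / 2` away from its projection `p` on `L`. The point stays in `K`, but the
  -- supporting hyperplane at `p` keeps it at distance at least `δ / 2` from `L`.
  set q := x + (δ / 2 / ‖x - p‖) • (x - p) with hq
  have hqK : q ∈ (K : Set (E n)) := by
    refine interior_subset (hsub (mem_thickening_iff.2 ⟨x, hx, ?_⟩))
    rw [hq, dist_eq_norm, add_sub_cancel_left, norm_smul, Real.norm_eq_abs,
      abs_of_pos (by positivity), div_mul_cancel₀ _ hxp.ne']
    linarith
  rw [mem_ball, dist_comm, NonemptyCompacts.dist_eq] at hL
  obtain ⟨p', hp'L, hd⟩ := exists_dist_lt_of_hausdorffDist_lt hqK hL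
    (hausdorffEDist_ne_top_of_nonempty_of_bounded K.nonempty L.nonempty K.isCompact.isBounded
      L.isCompact.isBounded)
  have h1 : inner ℝ (x - p) (q - p') ≤ ‖x - p‖ * ‖q - p'‖ := real_inner_le_norm _ _
  have h2 : q - p' = (x - p) + (δ / 2 / ‖x - p‖) • (x - p) - (p' - p) := by rw [hq]; abel
  have h3 : inner ℝ (x - p) (q - p') ≥ ‖x - p‖ * (δ / 2) := by
    rw [h2, inner_sub_right, inner_add_right, inner_smul_right, real_inner_self_eq_norm_sq]
    have : δ / 2 / ‖x - p‖ * ‖x - p‖ ^ 2 = ‖x - p‖ * (δ / 2) := by field_simp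
    have := hp' p' hp'L
    nlinarith [sq_nonneg ‖x - p‖]
  rw [dist_eq_norm] at hd
  nlinarith

/-- Moving `y` slightly further from `z` stays in the polar and scales the inner product by `1 + t`.
Strictness makes the condition open, as the tube lemma requires. -/
theorem inner_lt_one_of_mem_interior_polarAt {K : Set (E n)} {z y : E n}
    (hy : y ∈ interior (polarAt K z)) {x : E n} (hx : x ∈ K) : inner ℝ (x - z) (y - z) < 1 := by
  have h1 : Filter.Tendsto (fun t : ℝ => y + t • (y - z)) (𝓝[>] 0) (𝓝 y) := by
    have : Continuous fun t : ℝ => y + t • (y - z) := by fun_prop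
    simpa using (this.tendsto 0).mono_left nhdsWithin_le_nhds
  obtain ⟨t, ht, ht0⟩ := ((h1.eventually (mem_interior_iff_mem_nhds.1 hy)).and
    self_mem_nhdsWithin).exists
  have h2 := mem_polarAt.1 ht x hx
  have h3 : y + t • (y - z) - z = (1 + t) • (y - z) := by module
  rw [h3, inner_smul_right] at h2
  have ht0 : 0 < t := ht0
  by_contra! h
  nlinarith

theorem eventually_subset_polarAt {K : NonemptyCompacts (E n)} {z : E n} {C : Set (E n)}
    (hC : IsCompact C) (hCK : C ⊆ interior (polarAt (K : Set (E n)) z)) :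
    ∀ᶠ p : NonemptyCompacts (E n) × E n in 𝓝 (K, z), C ⊆ polarAt (p.1 : Set (E n)) p.2 := by
  -- The strict inequality holds on the compact set K × {z} × C, hence on a neighbourhood. A second
  -- tube argument separates the body from the base point.
  obtain ⟨U, V, hU, -, hKU, hCV, hUV⟩ := generalized_tube_lemma
    (K.isCompact.prod (isCompact_singleton (x := z))) hC
    (n := {q : (E n × E n) × E n | inner ℝ (q.1.1 - q.1.2) (q.2 - q.1.2) < 1})
    (isOpen_lt (by fun_prop) continuous_const) (by
      rintro ⟨⟨x, w⟩, y⟩ ⟨⟨hx, rfl⟩, hy⟩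
      exact inner_lt_one_of_mem_interior_polarAt (hCK hy) hx)
  obtain ⟨U', W, hU', hW, hKU', hzW, hUW⟩ := generalized_tube_lemma K.isCompact
    (isCompact_singleton (x := z)) hU hKU
  have h1 : {L : NonemptyCompacts (E n) | (L : Set (E n)) ⊆ U'} ∈ 𝓝 K :=
    (NonemptyCompacts.isOpen_subsets_of_isOpen hU').mem_nhds hKU'
  filter_upwards [prod_mem_nhds h1 (hW.mem_nhds (hzW rfl))] with p hp y hy
  refine mem_polarAt.2 fun x hx => (?_ : _ < _).le
  exact hUV (show ((x, p.2), y) ∈ U ×ˢ V from ⟨hUW ⟨hp.1 hx, hp.2⟩, hCV hy⟩)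

/-- Joint lower semicontinuity. The product of volumes is the measure of int K × int K^z, so one
compact subset nearly exhausts both factors, and its two projections remain inside nearby bodies and
their polars. -/
theorem eventually_lt_volumeProductAt {K : NonemptyCompacts (E n)} {z : E n}
    (hK : Convex ℝ (K : Set (E n))) {c : ENNReal} (hc : c < volumeProductAt (K : Set (E n)) z) :
    ∀ᶠ p : NonemptyCompacts (E n) × E n in 𝓝 (K, z), Convex ℝ (p.1 : Set (E n)) →
      c < volumeProductAt (p.1 : Set (E n)) p.2 := by
  have h : c < (volume.prod volume)
      (interior (K : Set (E n)) ×ˢ interior (polarAt (K : Set (E n)) z)) := by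
    rwa [Measure.prod_prod, volume_interior_eq hK, volume_interior_eq (convex_polarAt _ _)]
  obtain ⟨C, hCsub, hC, hcC⟩ := (isOpen_interior.prod isOpen_interior).exists_lt_isCompact h
  have h1 : Prod.fst '' C ⊆ interior (K : Set (E n)) := by
    rintro _ ⟨q, hq, rfl⟩; exact (hCsub hq).1
  have h2 : Prod.snd '' C ⊆ interior (polarAt (K : Set (E n)) z) := by
    rintro _ ⟨q, hq, rfl⟩; exact (hCsub hq).2
  filter_upwards [eventually_subset_polarAt (hC.image continuous_snd) h2,
    (continuous_fst.tendsto (K, z)).eventually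
      (eventually_subset_of_subset_interior (hC.image continuous_fst) h1)] with p hp2 hp1 hconv
  calc c < (volume.prod volume) C := hcC
    _ ≤ (volume.prod volume) ((Prod.fst '' C) ×ˢ (Prod.snd '' C)) :=
        measure_mono fun q hq => ⟨⟨q, hq, rfl⟩, ⟨q, hq, rfl⟩⟩
    _ = volume (Prod.fst '' C) * volume (Prod.snd '' C) := Measure.prod_prod _ _
    _ ≤ _ := by
        rw [volumeProductAt]
        gcongr
        exact hp1 hconv

theorem isClosed_setOf_convex :
    IsClosed {K : NonemptyCompacts (E n) | Convex ℝ (K : Set (E n))} := by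
  rw [← isOpen_compl_iff, Metric.isOpen_iff]
  intro K hK
  simp only [Set.mem_compl_iff, Set.mem_ofPred_eq, Convex, StarConvex] at hK
  push Not at hK
  obtain ⟨x, hx, y, hy, a, b, ha, hb, hab, hz⟩ := hK
  obtain ⟨ε, hε, hball⟩ := Metric.isOpen_iff.1 K.isCompact.isClosed.isOpen_compl _ hz
  refine ⟨ε / 2, half_pos hε, fun L hL hconv => ?_⟩
  have hfin : hausdorffEDist (K : Set (E n)) (L : Set (E n)) ≠ ⊤ :=
    hausdorffEDist_ne_top_of_nonempty_of_bounded K.nonempty L.nonempty K.isCompact.isBounded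
      L.isCompact.isBounded
  rw [mem_ball, dist_comm, NonemptyCompacts.dist_eq] at hL
  obtain ⟨x', hx', hdx⟩ := exists_dist_lt_of_hausdorffDist_lt hx hL hfin
  obtain ⟨y', hy', hdy⟩ := exists_dist_lt_of_hausdorffDist_lt hy hL hfin
  obtain ⟨w, hw, hdw⟩ := exists_dist_lt_of_hausdorffDist_lt' (hconv hx' hy' ha hb hab) hL hfin
  refine hball ?_ hw
  rw [mem_ball]
  have h1 : dist (a • x' + b • y') (a • x + b • y) ≤ ε / 2 := by
    rw [dist_eq_norm, show a • x' + b • y' - (a • x + b • y) = a • (x' - x) + b • (y' - y) by module]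
    refine (norm_add_le _ _).trans ?_
    rw [norm_smul, norm_smul, Real.norm_eq_abs, Real.norm_eq_abs, abs_of_nonneg ha,
      abs_of_nonneg hb, ← dist_eq_norm, ← dist_eq_norm, dist_comm x', dist_comm y']
    nlinarith
  linarith [dist_triangle w (a • x' + b • y') (a • x + b • y)]

/-- For a convex body, the volume product is attained. -/
theorem exists_volumeProduct_eq {K : Set (E n)} (hK : IsConvexBody K) :
    ∃ z ∈ interior K, volumeProduct K = (volumeProductAt K z).toReal := by
  let K' : NonemptyCompacts (E n) := ⟨⟨K, hK.isCompact⟩, hK.nonempty⟩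
  have hlsc : LowerSemicontinuousOn (volumeProductAt K) K := fun z _ c hc => by
    refine nhdsWithin_le_nhds ?_
    have h1 : Filter.Tendsto (fun w : E n => (K', w)) (𝓝 z) (𝓝 (K', z)) :=
      (Continuous.prodMk_right K').tendsto z
    filter_upwards [h1.eventually (eventually_lt_volumeProductAt (K := K') hK.convex hc)] with w hw
    exact hw hK.convex
  -- Minimizing over all of `K` costs nothing, since boundary points have value `⊤`.
  obtain ⟨z, hzK, hz⟩ := hlsc.exists_isMinOn hK.nonempty hK.isCompact
  obtain ⟨w, hw⟩ := hK.nonempty_interior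
  have hfin : volumeProductAt K z < ⊤ :=
    (hz (interior_subset hw)).trans_lt (volumeProductAt_lt_top hK hw)
  have hzint : z ∈ interior K := by
    by_contra h
    exact hfin.ne (volumeProductAt_eq_top hK h)
  refine ⟨z, hzint, le_antisymm (volumeProduct_le hzint) ?_⟩
  rw [volumeProduct_eq_iInf]
  have : Nonempty (interior K) := ⟨⟨z, hzint⟩⟩
  exact le_ciInf fun y => ENNReal.toReal_mono (volumeProductAt_lt_top hK y.2).ne
    (hz (interior_subset y.2))

/-! ### Simplices and normalization -/

/-- The vertices of the model simplex. -/
noncomputable def simplexVertex (n : ℕ) : Fin (n + 1) → E n :=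
  Fin.cons 0 fun i => EuclideanSpace.single i 1

theorem convex_simplex (n : ℕ) : Convex ℝ (simplex n) := by
  intro x hx y hy a b ha hb hab
  refine ⟨fun i => ?_, ?_⟩
  · have := hx.1 i; have := hy.1 i
    simp only [PiLp.add_apply, PiLp.smul_apply, smul_eq_mul]; positivity
  · simp only [PiLp.add_apply, PiLp.smul_apply, smul_eq_mul, Finset.sum_add_distrib,
      ← Finset.mul_sum]
    nlinarith [hx.2, hy.2]

theorem isClosed_simplex (n : ℕ) : IsClosed (simplex n) := by
  have : simplex n = (⋂ i, {x : E n | 0 ≤ x i}) ∩ {x | ∑ i, x i ≤ 1} := by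
    ext; simp [simplex]
  rw [this]
  exact (isClosed_iInter fun i => isClosed_le continuous_const (by fun_prop)).inter
    (isClosed_le (by fun_prop) continuous_const)

theorem norm_le_of_forall_abs_le_one {x : E n} (hx : ∀ i, |x i| ≤ 1) : ‖x‖ ≤ n := by
  have h : ‖x‖ ^ 2 ≤ (n : ℝ) := by
    rw [EuclideanSpace.norm_sq_eq]
    calc ∑ i, ‖x i‖ ^ 2 ≤ ∑ _i : Fin n, (1 : ℝ) :=
          Finset.sum_le_sum fun i _ => pow_le_one₀ (norm_nonneg _) (hx i)
      _ = n := by simp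
  have h2 : (n : ℝ) ≤ (n : ℝ) ^ 2 := by exact_mod_cast Nat.le_self_pow two_ne_zero n
  exact (pow_le_pow_iff_left₀ (norm_nonneg _) (by positivity) two_ne_zero).1 (h.trans h2)

theorem simplex_coord_le_one {x : E n} (hx : x ∈ simplex n) (i : Fin n) : x i ≤ 1 :=
  (Finset.single_le_sum (fun j _ => hx.1 j) (Finset.mem_univ i)).trans hx.2

theorem isCompact_simplex (n : ℕ) : IsCompact (simplex n) := by
  refine isCompact_of_isClosed_isBounded (isClosed_simplex n)
    (isBounded_iff_forall_norm_le.2 ⟨n, fun x hx => norm_le_of_forall_abs_le_one fun i => ?_⟩)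
  rw [abs_of_nonneg (hx.1 i)]
  exact simplex_coord_le_one hx i

theorem interior_simplex_supset {x : E n} (h : ∀ i, 0 < x i) (h1 : ∑ i, x i < 1) :
    x ∈ interior (simplex n) := by
  have hopen : IsOpen ((⋂ i, {x : E n | 0 < x i}) ∩ {x | ∑ i, x i < 1}) :=
    (isOpen_iInter_of_finite fun i => isOpen_lt continuous_const (by fun_prop)).inter
      (isOpen_lt (by fun_prop) continuous_const)
  refine interior_maximal ?_ hopen ⟨by simpa using h, h1⟩
  rintro y ⟨hy, hy1⟩
  exact ⟨fun i => (Set.mem_iInter.1 hy i : _ < _).le, (show _ < _ from hy1).le⟩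

theorem centroid_mem_interior_simplex (n : ℕ) :
    WithLp.toLp 2 (fun _ => ((n : ℝ) + 1)⁻¹) ∈ interior (simplex n) := by
  refine interior_simplex_supset (fun i => ?_) ?_
  · simp only; positivity
  · simp only [Finset.sum_const, Finset.card_univ, Fintype.card_fin, nsmul_eq_mul]
    rw [← div_eq_mul_inv, div_lt_one (by positivity)]
    linarith

theorem isConvexBody_simplex (n : ℕ) : IsConvexBody (simplex n) where
  convex := convex_simplex n
  isCompact := isCompact_simplex n
  nonempty_interior := ⟨_, centroid_mem_interior_simplex n⟩

theorem simplexVertex_mem (i : Fin (n + 1)) : simplexVertex n i ∈ simplex n := by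
  refine Fin.cases ?_ (fun j => ?_) i
  · simp [simplexVertex, simplex]
  · refine ⟨fun k => ?_, ?_⟩
    · simp only [simplexVertex, Fin.cons_succ, PiLp.single_apply]; split_ifs <;> norm_num
    · simp [simplexVertex]

theorem simplex_subset_of_convex {L : Set (E n)} (hL : Convex ℝ L)
    (h : ∀ i, simplexVertex n i ∈ L) : simplex n ⊆ L := by
  intro x hx
  have h1 : ∑ i : Fin (n + 1), (Fin.cons (1 - ∑ i, x i) x : Fin (n + 1) → ℝ) i •
      simplexVertex n i ∈ L := by
    refine hL.sum_mem (fun i _ => ?_) ?_ fun i _ => h i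
    · refine Fin.cases ?_ (fun j => ?_) i
      · simpa using hx.2
      · simpa using hx.1 j
    · simp [Fin.sum_univ_succ]
  convert h1
  ext j
  simp [Fin.sum_univ_succ, simplexVertex, Pi.single_apply]

theorem simplex_eq_convexHull (n : ℕ) : simplex n = convexHull ℝ (Set.range (simplexVertex n)) :=
  Set.Subset.antisymm
    (simplex_subset_of_convex (convex_convexHull _ _) fun i =>
      subset_convexHull _ _ (Set.mem_range_self i))
    (convexHull_min (Set.range_subset_iff.2 simplexVertex_mem) (convex_simplex n))

theorem affImage_convexHull (A : E n ≃L[ℝ] E n) (v : E n) (s : Set (E n)) :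
    affImage A v (convexHull ℝ s) = convexHull ℝ (affImage A v s) := by
  have h := ((A : E n →ₗ[ℝ] E n).toAffineMap + AffineMap.const ℝ (E n) v).image_convexHull s
  exact h

/-- The linear isomorphism sending a basis to the standard basis. -/
noncomputable def coordEquiv (b : Module.Basis (Fin n) ℝ (E n)) : E n ≃L[ℝ] E n :=
  (b.equivFun.trans (WithLp.linearEquiv 2 ℝ (Fin n → ℝ)).symm).toContinuousLinearEquiv

theorem coordEquiv_apply (b : Module.Basis (Fin n) ℝ (E n)) (x : E n) (i : Fin n) :
    coordEquiv b x i = b.repr x i := rfl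

theorem coordEquiv_basis (b : Module.Basis (Fin n) ℝ (E n)) (i : Fin n) :
    coordEquiv b (b i) = EuclideanSpace.single i 1 := by
  ext j
  rw [coordEquiv_apply, b.repr_self, PiLp.single_apply, Finsupp.single_apply]
  simp [eq_comm]

theorem coordEquiv_symm_single (b : Module.Basis (Fin n) ℝ (E n)) (i : Fin n) :
    (coordEquiv b).symm (EuclideanSpace.single i 1) = b i := by
  rw [← coordEquiv_basis, ContinuousLinearEquiv.symm_apply_apply]

theorem IsSimplex.exists_affImage {K : Set (E n)} (hK : IsSimplex K) :
    ∃ (A : E n ≃L[ℝ] E n) (v : E n), K = affImage A v (simplex n) := by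
  obtain ⟨p, hp, rfl⟩ := hK
  have hli : LinearIndependent ℝ fun i : Fin n => p i.succ - p 0 := by
    rw [affineIndependent_iff_linearIndependent_vsub ℝ p 0] at hp
    exact hp.comp (fun i : Fin n => (⟨i.succ, Fin.succ_ne_zero i⟩ : {x // x ≠ (0 : Fin (n + 1))}))
      fun i j h => Fin.succ_injective _ (Subtype.mk.inj h)
  let b : Module.Basis (Fin n) ℝ (E n) := Module.Basis.mk hli (by
    rw [hli.span_eq_top_of_card_eq_finrank' (by simp)])
  have hb : ∀ i, b i = p i.succ - p 0 := fun i => by simp [b]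
  refine ⟨(coordEquiv b).symm, p 0, ?_⟩
  rw [simplex_eq_convexHull, affImage_convexHull, affImage, ← Set.range_comp]
  congr 2
  ext1 i
  refine Fin.cases ?_ (fun j => ?_) i
  · simp [simplexVertex]
  · simp [simplexVertex, coordEquiv_symm_single, hb]

theorem IsSimplex.affImage {K : Set (E n)} (hK : IsSimplex K) (A : E n ≃L[ℝ] E n) (v : E n) :
    IsSimplex (affImage A v K) := by
  obtain ⟨p, hp, rfl⟩ := hK
  refine ⟨fun i => A (p i) + v, ?_, ?_⟩
  · have h := hp.map' ((A : E n →ₗ[ℝ] E n).toAffineMap + AffineMap.const ℝ (E n) v)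
      fun x y hxy => A.injective (add_right_cancel (show A x + v = A y + v from hxy))
    exact h
  · rw [affImage_convexHull, SlicingMahler.affImage, ← Set.range_comp]
    rfl

/-- Every convex body has an affine image lying between the model simplex and a fixed ball. -/
theorem IsConvexBody.exists_affImage_normalized {K : Set (E n)} (hK : IsConvexBody K) :
    ∃ (A : E n ≃L[ℝ] E n) (v : E n),
      simplex n ⊆ SlicingMahler.affImage A v K ∧
        SlicingMahler.affImage A v K ⊆ closedBall 0 n := by
  let M : (Fin (n + 1) → E n) → Matrix (Fin n) (Fin n) ℝ :=
    fun p => Matrix.of fun i j => (p i.succ - p 0) j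
  have hcont : Continuous fun p => |(M p).det| := by
    refine continuous_abs.comp (Continuous.matrix_det ?_)
    refine continuous_matrix fun i j => ?_
    simp only [M, Matrix.of_apply]
    fun_prop
  -- Choose a simplex of maximal volume with vertices in `K`; it will be mapped to the model
  -- simplex.
  obtain ⟨p, hpK, hmax⟩ := (isCompact_univ_pi fun _ : Fin (n + 1) => hK.isCompact).exists_isMaxOn
    (Set.univ_pi_nonempty_iff.2 fun _ => hK.nonempty) hcont.continuousOn
  have hpK' : ∀ i, p i ∈ K := fun i => hpK i trivial
  have hdet : (M p).det ≠ 0 := by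
    obtain ⟨x, hx⟩ := hK.nonempty_interior
    obtain ⟨r, hr, hball⟩ := Metric.isOpen_iff.1 isOpen_interior x hx
    let q : Fin (n + 1) → E n := Fin.cons x fun i => x + (r / 2) • EuclideanSpace.single i 1
    have hq : q ∈ Set.univ.pi fun _ : Fin (n + 1) => K := by
      intro i _
      refine Fin.cases ?_ (fun j => ?_) i
      · exact interior_subset hx
      · refine interior_subset (hball ?_)
        simp only [q, Fin.cons_succ, mem_ball, dist_eq_norm, add_sub_cancel_left, norm_smul,
          PiLp.norm_single, norm_one, mul_one, Real.norm_eq_abs]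
        rw [abs_of_pos (by positivity)]
        linarith
    have hMq : M q = (r / 2) • (1 : Matrix (Fin n) (Fin n) ℝ) := by
      ext i j
      simp [M, q, PiLp.single_apply, Matrix.one_apply, eq_comm]
    have h1 : |(M q).det| ≤ |(M p).det| := hmax hq
    rw [hMq, Matrix.det_smul, Matrix.det_one, mul_one] at h1
    have h2 : 0 < |(r / 2) ^ Fintype.card (Fin n)| := by positivity
    exact abs_pos.1 (h2.trans_le h1)
  have hli : LinearIndependent ℝ fun i : Fin n => p i.succ - p 0 := by
    have h1 : LinearIndependent ℝ (M p).row :=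
      Matrix.linearIndependent_rows_iff_isUnit.2 ((Matrix.isUnit_iff_isUnit_det _).2 hdet.isUnit)
    refine LinearIndependent.of_comp (WithLp.linearEquiv 2 ℝ (Fin n → ℝ)).toLinearMap ?_
    exact h1
  let b : Module.Basis (Fin n) ℝ (E n) := Module.Basis.mk hli (by
    rw [hli.span_eq_top_of_card_eq_finrank' (by simp)])
  have hb : ∀ i, b i = p i.succ - p 0 := fun i => by simp [b]
  refine ⟨coordEquiv b, -coordEquiv b (p 0), ?_, ?_⟩
  · refine simplex_subset_of_convex (convex_affImage _ _ hK.convex) fun i => ⟨p i, hpK' i, ?_⟩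
    refine Fin.cases ?_ (fun j => ?_) i
    · simp [simplexVertex]
    · beta_reduce
      rw [← sub_eq_add_neg, ← map_sub, ← hb, coordEquiv_basis]
      simp [simplexVertex]
  · rintro _ ⟨x, hx, rfl⟩
    rw [mem_closedBall_zero_iff]
    refine norm_le_of_forall_abs_le_one fun i => ?_
    beta_reduce
    rw [← sub_eq_add_neg, ← map_sub, coordEquiv_apply]
    -- By Cramer's rule, replacing one vertex by `x` multiplies the determinant by a coordinate of
    -- `x - p 0`. Maximality therefore bounds every such coordinate by 1.
    have hupd : M (Function.update p i.succ x) =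
        (M p).updateRow i (∑ k, b.repr (x - p 0) k • M p k) := by
      have hsum : x - p 0 = ∑ k, b.repr (x - p 0) k • (p k.succ - p 0) := by
        simp_rw [← hb]
        exact (b.sum_repr _).symm
      ext k j
      rcases eq_or_ne k i with rfl | hk
      · rw [Matrix.updateRow_self]
        simp only [M, Matrix.of_apply, Function.update_self,
          Function.update_of_ne (Fin.succ_ne_zero k).symm]
        conv_lhs => rw [hsum]
        simp [Finset.sum_apply]
      · rw [Matrix.updateRow_ne hk]
        simp only [M, Matrix.of_apply, Function.update_of_ne (Fin.succ_ne_zero i).symm]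
        rw [Function.update_of_ne (fun h => hk (Fin.succ_injective _ h))]
    have h1 : |(M (Function.update p i.succ x)).det| ≤ |(M p).det| := hmax (by
      intro k _
      rcases eq_or_ne k i.succ with rfl | hk
      · simpa using hx
      · simpa [Function.update_of_ne hk] using hpK' k)
    rw [hupd, Matrix.det_updateRow_sum, smul_eq_mul, abs_mul] at h1
    exact le_of_mul_le_mul_right (by simpa using h1) (abs_pos.2 hdet)

/-- There is a convex body with minimal volume product. -/
theorem exists_forall_volumeProductAt_le (n : ℕ) :
    ∃ (K : Set (E n)) (z : E n), IsConvexBody K ∧ z ∈ interior K ∧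
      ∀ (L : Set (E n)) (w : E n), IsConvexBody L → volumeProductAt K z ≤ volumeProductAt L w := by
  -- A compact family of normalized bodies. Containing the model simplex is closed under Hausdorff
  -- limits and prevents the interior from collapsing.
  let S : Set (NonemptyCompacts (E n)) :=
    {K | (K : Set (E n)) ⊆ closedBall 0 n} ∩
      ({K | Convex ℝ (K : Set (E n))} ∩ {K | simplex n ⊆ (K : Set (E n))})
  have hclosed : IsClosed {K : NonemptyCompacts (E n) | simplex n ⊆ (K : Set (E n))} := by
    have : {K : NonemptyCompacts (E n) | simplex n ⊆ (K : Set (E n))} =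
        ⋂ x ∈ simplex n, {K : NonemptyCompacts (E n) | infDist x (K : Set (E n)) ≤ 0} := by
      ext K
      simp only [Set.mem_ofPred_eq, Set.mem_iInter]
      refine forall₂_congr fun x _ => ?_
      rw [K.isCompact.isClosed.mem_iff_infDist_zero K.nonempty]
      exact ⟨le_of_eq, fun h => le_antisymm h infDist_nonneg⟩
    rw [this]
    exact isClosed_biInter fun x _ =>
      isClosed_le (lipschitz_infDist_set x).continuous continuous_const
  have hS : IsCompact S :=
    (NonemptyCompacts.isCompact_subsets_of_isCompact (isCompact_closedBall _ _)).inter_right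
      (isClosed_setOf_convex.inter hclosed)
  have hbody : ∀ K ∈ S, IsConvexBody (K : Set (E n)) := fun K hK =>
    ⟨hK.2.1, K.isCompact, (isConvexBody_simplex n).nonempty_interior.mono
      (interior_mono hK.2.2)⟩
  have hlsc : LowerSemicontinuousOn
      (fun p : NonemptyCompacts (E n) × E n => volumeProductAt (p.1 : Set (E n)) p.2)
      (S ×ˢ closedBall 0 n) := by
    rintro ⟨K, z⟩ ⟨hK, -⟩ c hc
    filter_upwards [nhdsWithin_le_nhds (eventually_lt_volumeProductAt hK.2.1 hc),
      self_mem_nhdsWithin] with p hp hpS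
    exact hp hpS.1.2.1
  have hnorm : ∀ (L : Set (E n)) (w : E n), IsConvexBody L → w ∈ interior L →
      ∃ p ∈ S ×ˢ closedBall (0 : E n) n,
        volumeProductAt (p.1 : Set (E n)) p.2 = volumeProductAt L w := by
    intro L w hL hw
    obtain ⟨A, v, h1, h2⟩ := hL.exists_affImage_normalized
    have hb := hL.affImage A v
    let L' : NonemptyCompacts (E n) := ⟨⟨_, hb.isCompact⟩, hb.nonempty⟩
    exact ⟨(L', A w + v), ⟨⟨h2, hb.convex, h1⟩, h2 ⟨w, interior_subset hw, rfl⟩⟩,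
      volumeProductAt_affImage A v L w⟩
  obtain ⟨p₀, hp₀, -⟩ := hnorm _ _ (isConvexBody_simplex n) (centroid_mem_interior_simplex n)
  obtain ⟨⟨K, z⟩, hKz, hmin⟩ := hlsc.exists_isMinOn ⟨p₀, hp₀⟩
    (hS.prod (isCompact_closedBall _ _))
  have hle : ∀ (L : Set (E n)) (w : E n), IsConvexBody L →
      volumeProductAt (K : Set (E n)) z ≤ volumeProductAt L w := by
    intro L w hL
    by_cases hw : w ∈ interior L
    · obtain ⟨p, hp, h⟩ := hnorm L w hL hw
      rw [← h]
      exact hmin hp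
    · rw [volumeProductAt_eq_top hL hw]
      exact le_top
  refine ⟨K, z, hbody K hKz.1, ?_, hle⟩
  by_contra hz
  have h := (hle _ _ (isConvexBody_simplex n)).trans_lt
    (volumeProductAt_lt_top (isConvexBody_simplex n) (centroid_mem_interior_simplex n))
  exact h.ne (volumeProductAt_eq_top (hbody K hKz.1) hz)

/-! ### Projective perturbations -/

theorem hasFDerivAt_projective (a x : E n) (h : 1 + inner ℝ a x ≠ 0) :
    HasFDerivAt (fun x : E n => (1 + inner ℝ a x)⁻¹ • x)
      ((1 + inner ℝ a x)⁻¹ • ContinuousLinearMap.id ℝ (E n) +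
        ContinuousLinearMap.smulRight (-((1 + inner ℝ a x) ^ 2)⁻¹ • innerSL ℝ a) x) x := by
  have h1 : HasFDerivAt (fun x : E n => 1 + inner ℝ a x) (innerSL ℝ a) x :=
    ((innerSL ℝ a).hasFDerivAt (x := x)).const_add 1
  exact ((hasDerivAt_inv h).comp_hasFDerivAt x h1).smul (hasFDerivAt_id x)

/-- The derivative is `(1 + inner ℝ a x)⁻¹` times a rank-one perturbation of the identity, whose
determinant supplies one more such factor beyond the `n` scalar ones. -/
theorem det_projective (a x : E n) (h : 1 + inner ℝ a x ≠ 0) :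
    ((1 + inner ℝ a x)⁻¹ • ContinuousLinearMap.id ℝ (E n) +
        ContinuousLinearMap.smulRight (-((1 + inner ℝ a x) ^ 2)⁻¹ • innerSL ℝ a) x).det =
      (1 + inner ℝ a x)⁻¹ ^ (n + 1) := by
  have e : ((((1 + inner ℝ a x)⁻¹ • ContinuousLinearMap.id ℝ (E n) +
        ContinuousLinearMap.smulRight (-((1 + inner ℝ a x) ^ 2)⁻¹ • innerSL ℝ a) x :
          E n →L[ℝ] E n)) : E n →ₗ[ℝ] E n) = (1 + inner ℝ a x)⁻¹ • LinearMap.transvection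
      (-(1 + inner ℝ a x)⁻¹ • (innerSL ℝ a : E n →ₗ[ℝ] ℝ)) x := by
    refine LinearMap.ext fun y => ?_
    simp only [ContinuousLinearMap.coe_coe, add_apply, smul_apply,
      ContinuousLinearMap.id_apply,
      ContinuousLinearMap.smulRight_apply, LinearMap.smul_apply, LinearMap.transvection.apply,
      innerSL_apply_apply, smul_eq_mul, smul_add, smul_smul]
    congr 2
    field_simp
  rw [ContinuousLinearMap.det, e, LinearMap.det_smul, LinearMap.transvection.det, pow_succ,
    finrank_euclideanSpace_fin]
  congr 1
  simp only [LinearMap.smul_apply, ContinuousLinearMap.coe_coe, innerSL_apply_apply, smul_eq_mul]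
  field_simp
  ring

/-- The polar of a translate of `polar K` is a projective image of `K`. -/
theorem volume_polar_translate_polar_le {K : Set (E n)} (hK : IsConvexBody K)
    (h0 : (0 : E n) ∈ interior K) {a : E n} (ha : ∀ x ∈ K, |inner ℝ a x| ≤ 1 / 2) :
    volume (polar ((fun y => y + a) '' polar K)) ≤
      ∫⁻ x in K, ENNReal.ofReal ((1 + inner ℝ a x)⁻¹ ^ (n + 1)) := by
  have hpos : ∀ x ∈ K, 0 < 1 + inner ℝ a x := fun x hx => by
    have := abs_le.1 (ha x hx); linarith
  -- Only an upper bound is needed, so one inclusion suffices and injectivity of the projective map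
  -- plays no role.
  have hsub : polar ((fun y => y + a) '' polar K) ⊆ (fun x => (1 + inner ℝ a x)⁻¹ • x) '' K := by
    intro w hw
    have hw' : ∀ y ∈ polar K, inner ℝ y w ≤ 1 - inner ℝ a w := fun y hy => by
      have := hw _ ⟨y, hy, rfl⟩
      rw [inner_add_left] at this
      linarith
    -- Testing `w` against this point gives ⟨a,w⟩ ≤ 1/3, so the inverse projective map is defined at
    -- `w`.
    have h2a : (2 : ℝ) • a ∈ polar K := fun x hx => by
      rw [inner_smul_right, real_inner_comm]
      have := abs_le.1 (ha x hx); linarith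
    have haw : 0 < 1 - inner ℝ a w := by
      have := hw' _ h2a
      rw [real_inner_smul_left] at this
      linarith
    refine ⟨(1 - inner ℝ a w)⁻¹ • w, ?_, ?_⟩
    · rw [← polar_polar hK.convex hK.isCompact.isClosed (interior_subset h0)]
      intro y hy
      rw [inner_smul_right, inv_mul_le_iff₀ haw, mul_one]
      exact hw' y hy
    · simp only [inner_smul_right, smul_smul]
      have : (1 + (1 - inner ℝ a w)⁻¹ * inner ℝ a w)⁻¹ * (1 - inner ℝ a w)⁻¹ = 1 := by
        rw [← mul_inv, add_mul, mul_right_comm, inv_mul_cancel₀ haw.ne']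
        simp
      rw [this, one_smul]
  refine (measure_mono hsub).trans ((addHaar_image_le_lintegral_abs_det_fderiv volume
    hK.isCompact.isClosed.measurableSet fun x hx =>
      (hasFDerivAt_projective a x (hpos x hx).ne').hasFDerivWithinAt).trans_eq ?_)
  refine setLIntegral_congr_fun hK.isCompact.isClosed.measurableSet fun x hx => ?_
  simp only
  rw [det_projective a x (hpos x hx).ne', abs_of_pos (pow_pos (inv_pos.2 (hpos x hx)) _)]

/-- The competitor is the polar of M = K° + a, based at `-b`. The projective estimate applies once
to `K` and once to M; translating M back to K° leaves the shift `y + a`, the source of the mixed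
term ⟨b,a⟩. -/
theorem perturbed_volumeProductAt_le {K : Set (E n)} (hK : IsConvexBody K)
    (h0 : (0 : E n) ∈ interior K)
    (hmin : ∀ (L : Set (E n)) (w : E n), IsConvexBody L →
      volumeProductAt K 0 ≤ volumeProductAt L w)
    {a b : E n} (ha : ∀ x ∈ K, |inner ℝ a x| ≤ 1 / 2) (ha' : -a ∈ interior (polar K))
    (hb : ∀ y ∈ polar K, |inner ℝ b (y + a)| ≤ 1 / 2) :
    volume K * volume (polar K) ≤
      (∫⁻ x in K, ENNReal.ofReal ((1 + inner ℝ a x)⁻¹ ^ (n + 1))) *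
        ∫⁻ y in polar K, ENNReal.ofReal ((1 + inner ℝ b (y + a))⁻¹ ^ (n + 1)) := by
  have hL := hK.polar h0
  have e : (fun y => y + a) '' polar K =
      affImage (ContinuousLinearEquiv.refl ℝ (E n)) a (polar K) := rfl
  have hM : IsConvexBody ((fun y => y + a) '' polar K) := e ▸ hL.affImage _ _
  have hM0 : (0 : E n) ∈ interior ((fun y => y + a) '' polar K) := by
    rw [e, interior_affImage]
    exact ⟨-a, ha', by simp⟩
  have h1 := hmin _ (-b) (hM.polar hM0)
  rw [volumeProductAt, polarAt_zero, volumeProductAt, volume_polarAt] at h1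
  refine h1.trans (mul_le_mul' (volume_polar_translate_polar_le hK h0 ha) ?_)
  simp only [sub_neg_eq_add]
  refine (volume_polar_translate_polar_le hM hM0 (a := b) ?_).trans_eq ?_
  · rintro _ ⟨y, hy, rfl⟩
    exact hb y hy
  · have hmp : MeasurePreserving (fun y : E n => y + a) := measurePreserving_add_right volume a
    exact (hmp.setLIntegral_comp_emb (MeasurableEquiv.addRight a).measurableEmbedding
      (fun y => ENNReal.ofReal ((1 + inner ℝ b y)⁻¹ ^ (n + 1))) (polar K)).symm

/-! ### Second-order expansion -/

/-- Induction on `N`: dividing by `1 + u`, which is at least 1/2, at most doubles the remainder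
together with the new cubic term. -/
theorem exists_abs_inv_pow_sub_le (N : ℕ) :
    ∃ C : ℝ, 0 ≤ C ∧ ∀ u : ℝ, |u| ≤ 1 / 2 →
      |(1 + u)⁻¹ ^ N - (1 - N * u + N * (N + 1) / 2 * u ^ 2)| ≤ C * |u| ^ 3 := by
  induction N with
  | zero => exact ⟨0, le_rfl, fun u _ => by simp⟩
  | succ N ih =>
    obtain ⟨C, hC, h⟩ := ih
    refine ⟨2 * (C + (N + 1) * (N + 2) / 2), by positivity, fun u hu => ?_⟩
    have hu' := abs_le.1 hu
    have h1 : 0 < 1 + u := by linarith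
    set r := (1 + u)⁻¹ ^ N - (1 - N * u + N * (N + 1) / 2 * u ^ 2) with hr
    have h2 : (1 + u)⁻¹ ^ (N + 1) -
        (1 - (N + 1 : ℕ) * u + (N + 1 : ℕ) * ((N + 1 : ℕ) + 1) / 2 * u ^ 2) =
        (1 + u)⁻¹ * (r - (N + 1) * (N + 2) / 2 * u ^ 3) := by
      have h3 : (1 + u)⁻¹ ^ N = r + (1 - N * u + N * (N + 1) / 2 * u ^ 2) := by rw [hr]; ring
      rw [pow_succ, h3]
      push_cast
      field_simp
      ring
    rw [h2, abs_mul, abs_of_pos (inv_pos.2 h1)]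
    have h4 : (1 + u)⁻¹ ≤ 2 := by
      rw [inv_le_comm₀ h1 two_pos]; linarith
    have h5 : |r - (N + 1) * (N + 2) / 2 * u ^ 3| ≤ (C + (N + 1) * (N + 2) / 2) * |u| ^ 3 := by
      refine (abs_sub _ _).trans ?_
      rw [abs_mul, abs_pow, abs_of_nonneg (show (0 : ℝ) ≤ (N + 1) * (N + 2) / 2 by positivity)]
      linarith [h u hu]
    rw [mul_assoc]
    exact mul_le_mul h4 h5 (abs_nonneg _) zero_le_two

/-- The constant depends on `β` only through its bound `B`, so the estimate can be integrated over a
body with `β = inner ℝ a x`. -/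
theorem exists_inv_pow_le (N : ℕ) (B s : ℝ) :
    ∃ c : ℝ, ∀ t β : ℝ, |β| ≤ B → |t| ≤ 1 → |t * β + t ^ 2 * s| ≤ 1 / 2 →
      (1 + (t * β + t ^ 2 * s))⁻¹ ^ N ≤
        1 - N * t * β - N * s * t ^ 2 + N * (N + 1) / 2 * t ^ 2 * β ^ 2 + c * |t| ^ 3 := by
  obtain ⟨C, hC, h⟩ := exists_abs_inv_pow_sub_le N
  refine ⟨N * (N + 1) / 2 * (2 * B * |s| + s ^ 2) + C * (B + |s|) ^ 3, fun t β hβ ht hu => ?_⟩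
  have h1 := (abs_le.1 (h _ hu)).2
  have ht0 := abs_nonneg t
  have h2 : |t * β + t ^ 2 * s| ≤ |t| * (B + |s|) := by
    refine (abs_add_le _ _).trans ?_
    rw [abs_mul, abs_mul, abs_pow]
    have : |t| ^ 2 ≤ |t| := by nlinarith
    nlinarith [abs_nonneg s, mul_le_mul_of_nonneg_left hβ ht0,
      mul_le_mul_of_nonneg_right this (abs_nonneg s)]
  have h3 : |t * β + t ^ 2 * s| ^ 3 ≤ |t| ^ 3 * (B + |s|) ^ 3 := by
    rw [← mul_pow]; gcongr
  have h4 : (t * β + t ^ 2 * s) ^ 2 ≤ t ^ 2 * β ^ 2 + |t| ^ 3 * (2 * B * |s| + s ^ 2) := by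
    have e : (t * β + t ^ 2 * s) ^ 2 = t ^ 2 * β ^ 2 + 2 * (t ^ 3 * (β * s)) + t ^ 4 * s ^ 2 := by
      ring
    have h5 : t ^ 3 * (β * s) ≤ |t| ^ 3 * (B * |s|) := by
      refine (le_abs_self _).trans ?_
      rw [abs_mul, abs_mul, abs_pow]
      gcongr
    have h6 : t ^ 4 ≤ |t| ^ 3 := by
      rw [← Even.pow_abs (by decide : Even 4) t, pow_succ]
      exact mul_le_of_le_one_right (by positivity) ht
    rw [e]
    nlinarith [sq_nonneg s]
  have h5 : (N : ℝ) * (N + 1) / 2 * (t * β + t ^ 2 * s) ^ 2 ≤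
      N * (N + 1) / 2 * (t ^ 2 * β ^ 2 + |t| ^ 3 * (2 * B * |s| + s ^ 2)) := by gcongr
  have h6 := mul_le_mul_of_nonneg_left h3 hC
  linarith

/-- Second-order upper bound for the integral of `(1 + t⟪a, x⟫ + t² s)⁻ᴺ`. -/
theorem exists_lintegral_inv_pow_le (N : ℕ) {K : Set (E n)} (hK : IsConvexBody K) (a : E n)
    (s : ℝ) : ∃ c δ : ℝ, 0 < δ ∧ ∀ t : ℝ, |t| ≤ δ →
      (∀ x ∈ K, |t * inner ℝ a x + t ^ 2 * s| ≤ 1 / 2) ∧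
      0 ≤ 1 - N * ((∫ x in K, inner ℝ a x) / volume.real K) * t +
          (N * (N + 1) / 2 * ((∫ x in K, (inner ℝ a x) ^ 2) / volume.real K) - N * s) * t ^ 2 +
          c * |t| ^ 3 ∧
      ∫⁻ x in K, ENNReal.ofReal ((1 + (t * inner ℝ a x + t ^ 2 * s))⁻¹ ^ N) ≤
        volume K * ENNReal.ofReal (1 - N * ((∫ x in K, inner ℝ a x) / volume.real K) * t +
          (N * (N + 1) / 2 * ((∫ x in K, (inner ℝ a x) ^ 2) / volume.real K) - N * s) * t ^ 2 +
          c * |t| ^ 3) := by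
  obtain ⟨B, hB0, hB⟩ : ∃ B : ℝ, 0 ≤ B ∧ ∀ x ∈ K, |inner ℝ a x| ≤ B := by
    obtain ⟨R, hR0, hR⟩ := hK.isCompact.isBounded.exists_pos_norm_le
    exact ⟨‖a‖ * R, by positivity, fun x hx => (abs_real_inner_le_norm a x).trans
      (by gcongr; exact hR x hx)⟩
  obtain ⟨c, hc⟩ := exists_inv_pow_le N B s
  have hV := hK.volumeReal_pos
  refine ⟨c, min 1 (1 / 2 / (B + |s| + 1)), by positivity, fun t ht => ?_⟩
  have ht1 : |t| ≤ 1 := ht.trans (min_le_left _ _)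
  have ht2 : |t| * (B + |s| + 1) ≤ 1 / 2 := by
    rw [← le_div_iff₀ (by positivity)]; exact ht.trans (min_le_right _ _)
  have hsmall : ∀ x ∈ K, |t * inner ℝ a x + t ^ 2 * s| ≤ 1 / 2 := fun x hx => by
    refine (abs_add_le _ _).trans ?_
    rw [abs_mul, abs_mul, abs_pow]
    have h1 : |t| ^ 2 ≤ |t| := by nlinarith [abs_nonneg t]
    nlinarith [mul_le_mul_of_nonneg_left (hB x hx) (abs_nonneg t),
      mul_le_mul_of_nonneg_right h1 (abs_nonneg s), abs_nonneg t]
  have hpt : ∀ x ∈ K, (1 + (t * inner ℝ a x + t ^ 2 * s))⁻¹ ^ N ≤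
      1 - N * t * inner ℝ a x - N * s * t ^ 2 + N * (N + 1) / 2 * t ^ 2 * (inner ℝ a x) ^ 2 +
        c * |t| ^ 3 := fun x hx => hc t _ (hB x hx) ht1 (hsmall x hx)
  have hnn : ∀ x ∈ K, 0 ≤ 1 - N * t * inner ℝ a x - N * s * t ^ 2 +
      N * (N + 1) / 2 * t ^ 2 * (inner ℝ a x) ^ 2 + c * |t| ^ 3 := fun x hx => by
    refine le_trans (pow_nonneg (inv_nonneg.2 ?_) _) (hpt x hx)
    have := abs_le.1 (hsmall x hx); linarith
  have hmeas : MeasurableSet K := hK.isCompact.isClosed.measurableSet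
  have hint : ∀ f : E n → ℝ, Continuous f → IntegrableOn f K := fun f hf =>
    hf.continuousOn.integrableOn_compact hK.isCompact
  have hI : ∫ x in K, (1 - N * t * inner ℝ a x - N * s * t ^ 2 +
      N * (N + 1) / 2 * t ^ 2 * (inner ℝ a x) ^ 2 + c * |t| ^ 3) = volume.real K *
        (1 - N * ((∫ x in K, inner ℝ a x) / volume.real K) * t +
          (N * (N + 1) / 2 * ((∫ x in K, (inner ℝ a x) ^ 2) / volume.real K) - N * s) * t ^ 2 +
          c * |t| ^ 3) := by
    obtain ⟨r, hr⟩ : ∃ r, r = 1 - N * s * t ^ 2 + c * |t| ^ 3 := ⟨_, rfl⟩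
    have e : ∀ x : E n, 1 - N * t * inner ℝ a x - N * s * t ^ 2 +
        N * (N + 1) / 2 * t ^ 2 * (inner ℝ a x) ^ 2 + c * |t| ^ 3 =
        r + ((-(N * t)) * inner ℝ a x + N * (N + 1) / 2 * t ^ 2 * (inner ℝ a x) ^ 2) := fun x => by
      rw [hr]; ring
    simp_rw [e]
    rw [integral_add (hint _ (by fun_prop)) (hint _ (by fun_prop)),
      integral_add (hint _ (by fun_prop)) (hint _ (by fun_prop)), integral_const_mul,
      integral_const_mul, setIntegral_const, smul_eq_mul, hr]
    field_simp
    ring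
  refine ⟨hsmall, ?_, ?_⟩
  -- Recorded because two `ENNReal.ofReal` bounds are later merged into the `ofReal` of a product.
  · refine nonneg_of_mul_nonneg_right (hI ▸ ?_) hV
    exact setIntegral_nonneg hmeas hnn
  · calc _ ≤ ∫⁻ x in K, ENNReal.ofReal (1 - N * t * inner ℝ a x - N * s * t ^ 2 +
            N * (N + 1) / 2 * t ^ 2 * (inner ℝ a x) ^ 2 + c * |t| ^ 3) :=
          setLIntegral_mono' hmeas fun x hx => ENNReal.ofReal_le_ofReal (hpt x hx)
      _ = _ := by
          rw [← ofReal_integral_eq_lintegral_ofReal (hint _ (by fun_prop))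
            (ae_restrict_of_forall_mem hmeas hnn), hI, ENNReal.ofReal_mul hV.le,
            ofReal_measureReal hK.isCompact.measure_lt_top.ne]

/-- Divide by `t` as `t → 0⁺`; both signs of `t` being allowed, the linear term vanishes, and
dividing by `t ^ 2` then settles the quadratic one. -/
theorem taylor_coeff_of_nonneg {p q c δ : ℝ} (hδ : 0 < δ)
    (h : ∀ t : ℝ, |t| ≤ δ → 0 ≤ p * t + q * t ^ 2 + c * |t| ^ 3) : p = 0 ∧ 0 ≤ q := by
  have hp : ∀ p' : ℝ, (∀ t : ℝ, |t| ≤ δ → 0 ≤ p' * t + q * t ^ 2 + c * |t| ^ 3) → 0 ≤ p' := by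
    intro p' h
    have h1 : Filter.Tendsto (fun t : ℝ => p' + q * t + c * t ^ 2) (𝓝[>] 0) (𝓝 p') := by
      have : Continuous fun t : ℝ => p' + q * t + c * t ^ 2 := by fun_prop
      simpa using (this.tendsto 0).mono_left nhdsWithin_le_nhds
    refine ge_of_tendsto h1 ?_
    filter_upwards [Ioc_mem_nhdsGT hδ] with t ht
    have h2 := h t (by rw [abs_of_pos ht.1]; exact ht.2)
    rw [abs_of_pos ht.1] at h2
    have h3 : 0 ≤ t * (p' + q * t + c * t ^ 2) := by linarith
    exact nonneg_of_mul_nonneg_right h3 ht.1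
  have hp0 : p = 0 := by
    refine le_antisymm ?_ (hp p h)
    have := hp (-p) fun t ht => by
      have := h (-t) (by rwa [abs_neg])
      rw [abs_neg] at this
      linarith
    linarith
  subst hp0
  refine ⟨rfl, ?_⟩
  have h1 : Filter.Tendsto (fun t : ℝ => q + c * t) (𝓝[>] 0) (𝓝 q) := by
    have : Continuous fun t : ℝ => q + c * t := by fun_prop
    simpa using (this.tendsto 0).mono_left nhdsWithin_le_nhds
  refine ge_of_tendsto h1 ?_
  filter_upwards [Ioc_mem_nhdsGT hδ] with t ht
  have h2 := h t (by rw [abs_of_pos ht.1]; exact ht.2)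
  rw [abs_of_pos ht.1] at h2
  have h3 : 0 ≤ t ^ 2 * (q + c * t) := by linarith
  exact nonneg_of_mul_nonneg_right h3 (pow_pos ht.1 2)

theorem taylor_coeff_of_one_le_mul {p₁ p₂ q₁ q₂ c d δ : ℝ} (hδ : 0 < δ)
    (h : ∀ t : ℝ, |t| ≤ δ →
      1 ≤ (1 + p₁ * t + p₂ * t ^ 2 + c * |t| ^ 3) * (1 + q₁ * t + q₂ * t ^ 2 + d * |t| ^ 3)) :
    p₁ + q₁ = 0 ∧ 0 ≤ p₂ + q₂ + p₁ * q₁ := by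
  refine taylor_coeff_of_nonneg (p := p₁ + q₁) (q := p₂ + q₂ + p₁ * q₁) (δ := min δ 1)
    -- The coefficients of all terms of order at least 3, each term being dominated by `|t| ^ 3`
    -- when `|t| ≤ 1`.
    (c := |c| + |d| + |p₁ * q₂| + |p₂ * q₁| + |p₁ * d| + |q₁ * c| + |p₂ * q₂| + |p₂ * d| + |q₂ * c|
      + |c * d|) (by positivity) fun t ht => ?_
  have h1 := h t (ht.trans (min_le_left _ _))
  have ht1 : |t| ≤ 1 := ht.trans (min_le_right _ _)
  have key : ∀ (x y : ℝ), |y| ≤ |t| ^ 3 → x * y ≤ |x| * |t| ^ 3 := fun x y hy => by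
    refine (le_abs_self _).trans ?_
    rw [abs_mul]
    gcongr
  have hpow : ∀ k : ℕ, |t| ^ (3 + k) ≤ |t| ^ 3 := fun k =>
    pow_le_pow_of_le_one (abs_nonneg t) ht1 (by omega)
  have e : (1 + p₁ * t + p₂ * t ^ 2 + c * |t| ^ 3) * (1 + q₁ * t + q₂ * t ^ 2 + d * |t| ^ 3) =
      1 + (p₁ + q₁) * t + (p₂ + q₂ + p₁ * q₁) * t ^ 2 + (c * |t| ^ 3 + d * |t| ^ 3 +
        (p₁ * q₂) * t ^ 3 + (p₂ * q₁) * t ^ 3 + (p₁ * d) * (t * |t| ^ 3) +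
        (q₁ * c) * (t * |t| ^ 3) + (p₂ * q₂) * t ^ 4 + (p₂ * d) * (t ^ 2 * |t| ^ 3) +
        (q₂ * c) * (t ^ 2 * |t| ^ 3) + (c * d) * (|t| ^ 3 * |t| ^ 3)) := by ring
  have b3 : |(|t| ^ 3)| ≤ |t| ^ 3 := by simp
  have b3' : |t ^ 3| ≤ |t| ^ 3 := by simp
  have b4 : |t ^ 4| ≤ |t| ^ 3 := by rw [abs_pow]; exact hpow 1
  have b4' : |t * |t| ^ 3| ≤ |t| ^ 3 := by
    rw [abs_mul, abs_pow, abs_abs, mul_comm]; exact hpow 1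
  have b5 : |t ^ 2 * |t| ^ 3| ≤ |t| ^ 3 := by
    rw [abs_mul, abs_pow, abs_pow, abs_abs, ← pow_add]; exact hpow 2
  have b6 : |(|t| ^ 3 * |t| ^ 3)| ≤ |t| ^ 3 := by
    rw [abs_mul, abs_pow, abs_abs, ← pow_add]; exact hpow 3
  rw [e] at h1
  linarith [key c _ b3, key d _ b3, key (p₁ * q₂) _ b3', key (p₂ * q₁) _ b3', key (p₁ * d) _ b4',
    key (q₁ * c) _ b4', key (p₂ * q₂) _ b4, key (p₂ * d) _ b5, key (q₂ * c) _ b5,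
    key (c * d) _ b6]

/-- First- and second-order optimality conditions for a minimizer of the volume product. -/
theorem optimality_conditions {K : Set (E n)} (hK : IsConvexBody K) (h0 : (0 : E n) ∈ interior K)
    (hmin : ∀ (L : Set (E n)) (w : E n), IsConvexBody L →
      volumeProductAt K 0 ≤ volumeProductAt L w) (a b : E n) :
    (∫ x in K, inner ℝ a x) / volume.real K + (∫ y in polar K, inner ℝ b y) / volume.real (polar K)
        = 0 ∧
      0 ≤ (n + 2) * ((∫ x in K, (inner ℝ a x) ^ 2) / volume.real K +
          (∫ y in polar K, (inner ℝ b y) ^ 2) / volume.real (polar K)) - 2 * inner ℝ b a +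
        2 * (n + 1) * ((∫ x in K, inner ℝ a x) / volume.real K *
          ((∫ y in polar K, inner ℝ b y) / volume.real (polar K))) := by
  have hL := hK.polar h0
  obtain ⟨c, δ, hδ, h1⟩ := exists_lintegral_inv_pow_le (n + 1) hK a 0
  obtain ⟨d, η, hη, h2⟩ := exists_lintegral_inv_pow_le (n + 1) hL b (inner ℝ b a)
  obtain ⟨ε, hε, h3⟩ : ∃ ε : ℝ, 0 < ε ∧ ∀ t : ℝ, |t| ≤ ε → -(t • a) ∈ interior (polar K) := by
    have hc : Continuous fun t : ℝ => -(t • a) := by fun_prop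
    have hn : interior (polar K) ∈ 𝓝 (-((0 : ℝ) • a)) := by
      rw [zero_smul, neg_zero]
      exact interior_mem_nhds.2 (polar_mem_nhds hK.isCompact.isBounded)
    obtain ⟨ε, hε, h⟩ := Metric.nhds_basis_closedBall.mem_iff.1 (hc.continuousAt hn)
    exact ⟨ε, hε, fun t ht => h (by simpa using ht)⟩
  have hvK := hK.volume_pos
  have hvL := hL.volume_pos
  have key := taylor_coeff_of_one_le_mul (δ := min δ (min η ε)) (c := c) (d := d)
    (p₁ := -((n + 1 : ℕ) * ((∫ x in K, inner ℝ a x) / volume.real K)))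
    (p₂ := (n + 1 : ℕ) * ((n + 1 : ℕ) + 1) / 2 *
      ((∫ x in K, (inner ℝ a x) ^ 2) / volume.real K) - (n + 1 : ℕ) * 0)
    (q₁ := -((n + 1 : ℕ) * ((∫ x in polar K, inner ℝ b x) / volume.real (polar K))))
    (q₂ := (n + 1 : ℕ) * ((n + 1 : ℕ) + 1) / 2 *
      ((∫ x in polar K, (inner ℝ b x) ^ 2) / volume.real (polar K)) - (n + 1 : ℕ) * inner ℝ b a)
    (by positivity) fun t ht => by
      obtain ⟨s1, n1, i1⟩ := h1 t (ht.trans (min_le_left _ _))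
      obtain ⟨s2, n2, i2⟩ := h2 t (ht.trans ((min_le_right _ _).trans (min_le_left _ _)))
      have e1 : ∀ x, inner ℝ (t • a) x = t * inner ℝ a x + t ^ 2 * 0 := fun x => by
        rw [real_inner_smul_left]; ring
      have e2 : ∀ y, inner ℝ (t • b) (y + t • a) = t * inner ℝ b y + t ^ 2 * inner ℝ b a :=
        fun y => by
          rw [real_inner_smul_left, inner_add_right, inner_smul_right]; ring
      have h4 := perturbed_volumeProductAt_le hK h0 hmin (a := t • a) (b := t • b)
        (fun x hx => e1 x ▸ s1 x hx)
        (h3 t (ht.trans ((min_le_right _ _).trans (min_le_right _ _))))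
        (fun y hy => e2 y ▸ s2 y hy)
      simp_rw [e1, e2] at h4
      have h5 := h4.trans (mul_le_mul' i1 i2)
      rw [mul_mul_mul_comm, ← ENNReal.ofReal_mul n1] at h5
      have hfin : volume K * volume (polar K) ≠ ⊤ :=
        ENNReal.mul_ne_top hK.isCompact.measure_lt_top.ne hL.isCompact.measure_lt_top.ne
      have hne : volume K * volume (polar K) ≠ 0 := mul_ne_zero hvK.ne' hvL.ne'
      have h6 := (ENNReal.mul_le_mul_iff_right hne hfin).1 ((mul_one _).le.trans h5)
      rw [ENNReal.one_le_ofReal] at h6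
      simpa only [← sub_eq_add_neg, neg_mul] using h6
  obtain ⟨k1, k2⟩ := key
  have hn1 : (0 : ℝ) < n + 1 := by positivity
  push_cast at k1 k2
  constructor
  · refine mul_left_cancel₀ hn1.ne' ?_
    linarith
  · refine nonneg_of_mul_nonneg_right (a := ((n : ℝ) + 1) / 2) ?_ (by positivity)
    linarith

/-! ### Covariance matrices -/

open scoped Matrix MatrixOrder Matrix.Norms.L2Operator in
theorem exists_isUnit_eq_transpose_mul_self {B : Matrix (Fin n) (Fin n) ℝ} (hB : B.PosDef) :
    ∃ C : Matrix (Fin n) (Fin n) ℝ, IsUnit C ∧ B = Cᵀ * C := by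
  obtain ⟨C, hC, h⟩ := CStarAlgebra.isStrictlyPositive_iff_eq_star_mul_self.mp
    hB.isStrictlyPositive
  exact ⟨C, hC, by rw [h, Matrix.star_eq_conjTranspose, Matrix.conjTranspose_eq_transpose_of_trivial]⟩

open scoped Matrix in
theorem posDef_of_forall_two_mul_dotProduct_le {A B : Matrix (Fin n) (Fin n) ℝ}
    (hA : A.IsHermitian) {κ : ℝ} (hκ : 0 < κ)
    (h : ∀ a b : Fin n → ℝ, 2 * (a ⬝ᵥ b) ≤ κ * (a ⬝ᵥ A *ᵥ a + b ⬝ᵥ B *ᵥ b)) : A.PosDef := by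
  refine Matrix.posDef_iff_dotProduct_mulVec.2 ⟨hA, fun a ha => ?_⟩
  rw [star_trivial]
  by_contra! hneg
  have haa : 0 < a ⬝ᵥ a := by
    have := Matrix.dotProduct_star_self_pos_iff.2 ha
    rwa [star_trivial] at this
  set q := a ⬝ᵥ B *ᵥ a with hq
  -- Test with `b = s • a`: the left side is linear in `s`, the right at most quadratic. This `s`
  -- makes the right side too small.
  set s := (a ⬝ᵥ a) / (κ * (|q| + 1)) with hs
  have hs0 : 0 < s := by positivity
  have h1 := h a (s • a)
  rw [Matrix.mulVec_smul, dotProduct_smul, smul_dotProduct, dotProduct_smul, ← hq] at h1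
  simp only [smul_eq_mul] at h1
  have h2 : s * (κ * (|q| + 1)) = a ⬝ᵥ a := by rw [hs]; field_simp
  have h3 : s * (2 * (a ⬝ᵥ a)) ≤ s * (κ * s * q) := by nlinarith
  have h4 := le_of_mul_le_mul_left h3 hs0
  have h5 : κ * s * q ≤ κ * s * (|q| + 1) := by
    have := le_abs_self q
    gcongr; linarith
  linarith

open scoped Matrix in
/-- If the block matrix `[[κ A, -1], [-1, κ B]]` is positive semidefinite then
`det A * det B ≥ κ⁻²ⁿ`. -/
theorem inv_pow_le_det_mul_det {A B : Matrix (Fin n) (Fin n) ℝ}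
    (hA : A.IsHermitian) (hB : B.IsHermitian) {κ : ℝ} (hκ : 0 < κ)
    (h : ∀ a b : Fin n → ℝ, 2 * (a ⬝ᵥ b) ≤ κ * (a ⬝ᵥ A *ᵥ a + b ⬝ᵥ B *ᵥ b)) :
    (κ⁻¹ ^ 2) ^ n ≤ A.det * B.det := by
  have hBpos : B.PosDef := posDef_of_forall_two_mul_dotProduct_le (B := A) hB hκ fun a b => by
    rw [dotProduct_comm, add_comm]; exact h b a
  obtain ⟨C, hC, rfl⟩ := exists_isUnit_eq_transpose_mul_self hBpos
  have hM : (C * A * Cᵀ).IsHermitian := by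
    rw [← Matrix.conjTranspose_eq_transpose_of_trivial]
    exact Matrix.isHermitian_mul_mul_conjTranspose C hA
  have hdet : A.det * (Cᵀ * C).det = (C * A * Cᵀ).det := by
    simp only [Matrix.det_mul]; ring
  rw [hdet, hM.det_eq_prod_eigenvalues]
  have hev : ∀ i, κ⁻¹ ^ 2 ≤ hM.eigenvalues i := by
    intro i
    set v : Fin n → ℝ := ⇑(hM.eigenvectorBasis i) with hv
    have hvv : v ⬝ᵥ v = 1 := by
      have h1 := hM.eigenvectorBasis.orthonormal.1 i
      have h2 := EuclideanSpace.norm_sq_eq (hM.eigenvectorBasis i)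
      rw [h1] at h2
      simp only [dotProduct, hv]
      rw [one_pow] at h2
      rw [h2]
      exact Finset.sum_congr rfl fun j _ => by rw [Real.norm_eq_abs, sq_abs, sq]
    have hlam : hM.eigenvalues i = (Cᵀ *ᵥ v) ⬝ᵥ A *ᵥ (Cᵀ *ᵥ v) := by
      rw [hM.eigenvalues_eq i, ← hv]
      simp only [star_trivial, RCLike.re_to_real, ← Matrix.mulVec_mulVec]
      rw [Matrix.dotProduct_mulVec v C, ← Matrix.mulVec_transpose]
    have hCdet : IsUnit C.det := (Matrix.isUnit_iff_isUnit_det C).1 hC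
    -- These vectors have pairing `κ⁻¹`, and their quadratic forms are the eigenvalue and `κ⁻¹ ^ 2`.
    -- The scaling `κ⁻¹` gives the best lower bound on the eigenvalue.
    have h1 := h (Cᵀ *ᵥ v) (κ⁻¹ • (C⁻¹ *ᵥ v))
    have hCC : C *ᵥ (C⁻¹ *ᵥ v) = v := by
      rw [Matrix.mulVec_mulVec, Matrix.mul_nonsing_inv C hCdet, Matrix.one_mulVec]
    have e1 : (Cᵀ *ᵥ v) ⬝ᵥ (C⁻¹ *ᵥ v) = 1 := by
      rw [Matrix.mulVec_transpose, ← Matrix.dotProduct_mulVec, hCC, hvv]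
    have e2 : (C⁻¹ *ᵥ v) ⬝ᵥ (Cᵀ * C) *ᵥ (C⁻¹ *ᵥ v) = 1 := by
      rw [← Matrix.mulVec_mulVec, Matrix.dotProduct_mulVec, hCC, ← Matrix.mulVec_transpose,
        Matrix.transpose_transpose, hCC, hvv]
    rw [dotProduct_smul, e1, Matrix.mulVec_smul, dotProduct_smul, smul_dotProduct, e2,
      ← hlam] at h1
    simp only [smul_eq_mul, mul_one] at h1
    have h2 : κ⁻¹ * κ = 1 := inv_mul_cancel₀ hκ.ne'
    nlinarith [mul_le_mul_of_nonneg_left h1 (inv_pos.2 hκ).le]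
  calc (κ⁻¹ ^ 2) ^ n = ∏ _i : Fin n, κ⁻¹ ^ 2 := by simp
    _ ≤ ∏ i, hM.eigenvalues i :=
        Finset.prod_le_prod (fun _ _ => by positivity) fun i _ => hev i
    _ = _ := by simp

theorem isHermitian_covMatrix (K : Set (E n)) : (covMatrix K).IsHermitian := by
  ext i j
  simp only [covMatrix, Matrix.conjTranspose_apply, Matrix.of_apply, star_trivial, mul_comm]

open scoped Matrix in
theorem dotProduct_covMatrix_mulVec {K : Set (E n)} (hK : IsConvexBody K) (a : Fin n → ℝ) :
    a ⬝ᵥ covMatrix K *ᵥ a =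
      (∫ x in K, (inner ℝ (WithLp.toLp 2 a) x) ^ 2) / volume.real K -
        ((∫ x in K, inner ℝ (WithLp.toLp 2 a) x) / volume.real K) ^ 2 := by
  have hint : ∀ f : E n → ℝ, Continuous f → IntegrableOn f K := fun f hf =>
    hf.continuousOn.integrableOn_compact hK.isCompact
  have e1 : ∀ x : E n, inner ℝ (WithLp.toLp 2 a) x = ∑ i, a i * x i := fun x => by
    simp [PiLp.inner_apply, mul_comm]
  have h1 : ∫ x in K, inner ℝ (WithLp.toLp 2 a) x = ∑ i, a i * ∫ x in K, x i := by
    simp_rw [e1]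
    rw [integral_finsetSum _ fun i _ => hint _ (by fun_prop)]
    simp_rw [integral_const_mul]
  have h2 : ∫ x in K, (inner ℝ (WithLp.toLp 2 a) x) ^ 2 =
      ∑ i, ∑ j, a i * a j * ∫ x in K, x i * x j := by
    have e2 : ∀ x : E n, (inner ℝ (WithLp.toLp 2 a) x) ^ 2 =
        ∑ i, ∑ j, a i * a j * (x i * x j) := fun x => by
      rw [e1, sq, Finset.sum_mul_sum]
      exact Finset.sum_congr rfl fun i _ => Finset.sum_congr rfl fun j _ => by ring
    simp_rw [e2]
    rw [integral_finsetSum _ fun i _ => hint _ (by fun_prop)]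
    refine Finset.sum_congr rfl fun i _ => ?_
    rw [integral_finsetSum _ fun j _ => hint _ (by fun_prop)]
    simp_rw [integral_const_mul]
  rw [h1, h2, sq, div_mul_div_comm, Finset.sum_mul_sum, Finset.sum_div, Finset.sum_div,
    ← Finset.sum_sub_distrib]
  simp only [dotProduct, Matrix.mulVec, covMatrix, Matrix.of_apply, Finset.mul_sum]
  refine Finset.sum_congr rfl fun i _ => ?_
  rw [Finset.sum_div, Finset.sum_div, ← Finset.sum_sub_distrib]
  refine Finset.sum_congr rfl fun j _ => ?_
  ring

/-- Klartag's inequality for the covariances of a minimizer of the volume product and its polar. -/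
theorem inv_pow_le_det_covMatrix_mul {K : Set (E n)} (hK : IsConvexBody K)
    (h0 : (0 : E n) ∈ interior K)
    (hmin : ∀ (L : Set (E n)) (w : E n), IsConvexBody L →
      volumeProductAt K 0 ≤ volumeProductAt L w) :
    (((n : ℝ) + 2)⁻¹ ^ 2) ^ n ≤ (covMatrix K).det * (covMatrix (polar K)).det := by
  have hL := hK.polar h0
  have opt := optimality_conditions hK h0 hmin
  -- Setting one vector to zero decouples the first-order condition: both bodies are centred, so
  -- second moments are covariances.
  have hm1 : ∀ a : E n, (∫ x in K, inner ℝ a x) / volume.real K = 0 := fun a => by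
    simpa using (opt a 0).1
  have hm2 : ∀ b : E n, (∫ x in polar K, inner ℝ b x) / volume.real (polar K) = 0 := fun b => by
    simpa using (opt 0 b).1
  refine inv_pow_le_det_mul_det (isHermitian_covMatrix K) (isHermitian_covMatrix _)
    (by positivity) fun a b => ?_
  have h := (opt (WithLp.toLp 2 a) (WithLp.toLp 2 b)).2
  rw [hm1, hm2, EuclideanSpace.inner_toLp_toLp, star_trivial] at h
  rw [dotProduct_covMatrix_mulVec hK, dotProduct_covMatrix_mulVec hL, hm1, hm2]
  linarith

open scoped Matrix in
theorem det_covMatrix_nonneg {K : Set (E n)} (hK : IsConvexBody K) : 0 ≤ (covMatrix K).det := by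
  refine Matrix.PosSemidef.det_nonneg (Matrix.posSemidef_iff_dotProduct_mulVec.2
    ⟨isHermitian_covMatrix K, fun a => ?_⟩)
  rw [star_trivial, dotProduct_covMatrix_mulVec hK]
  have hint : ∀ f : E n → ℝ, Continuous f → IntegrableOn f K := fun f hf =>
    hf.continuousOn.integrableOn_compact hK.isCompact
  have hV := hK.volumeReal_pos
  set m := (∫ x in K, inner ℝ (WithLp.toLp 2 a) x) / volume.real K with hm
  have h1 : 0 ≤ ∫ x in K, (inner ℝ (WithLp.toLp 2 a) x - m) ^ 2 :=
    integral_nonneg fun x => sq_nonneg _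
  have e : ∀ x : E n, (inner ℝ (WithLp.toLp 2 a) x - m) ^ 2 =
      (inner ℝ (WithLp.toLp 2 a) x) ^ 2 + ((-2 * m) * inner ℝ (WithLp.toLp 2 a) x + m ^ 2) :=
    fun x => by ring
  simp_rw [e] at h1
  rw [integral_add (hint _ (by fun_prop)) (hint _ (by fun_prop)),
    integral_add (hint _ (by fun_prop)) (hint _ (by fun_prop)), integral_const_mul,
    setIntegral_const, smul_eq_mul,
    show ∫ x in K, inner ℝ (WithLp.toLp 2 a) x = m * volume.real K by rw [hm]; field_simp] at h1
  rw [sub_nonneg, le_div_iff₀ hV]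
  linarith

/-! ### Dirichlet integrals over the simplex -/

theorem integrableOn_pow_mul_exp_neg (k : ℕ) :
    IntegrableOn (fun t : ℝ => t ^ k * Real.exp (-t)) (Set.Ioi 0) := by
  have h := Real.GammaIntegral_convergent (s := k + 1) (by positivity)
  refine h.congr_fun (fun t _ => ?_) measurableSet_Ioi
  simp only [add_sub_cancel_right, Real.rpow_natCast, mul_comm]

theorem integral_pow_mul_exp_neg (k : ℕ) :
    ∫ t in Set.Ioi (0 : ℝ), t ^ k * Real.exp (-t) = k.factorial := by
  rw [← Real.Gamma_nat_eq_factorial, Real.Gamma_eq_integral (by positivity)]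
  refine setIntegral_congr_fun measurableSet_Ioi fun t _ => ?_
  simp only [add_sub_cancel_right, Real.rpow_natCast, mul_comm]

/-- The nonnegative orthant. -/
def orthant (n : ℕ) : Set (Fin n → ℝ) := {x | ∀ i, 0 ≤ x i}

theorem measurableSet_orthant (n : ℕ) : MeasurableSet (orthant n) := by
  have : orthant n = ⋂ i, {x | 0 ≤ x i} := by ext; simp [orthant]
  rw [this]
  exact MeasurableSet.iInter fun i => measurableSet_le measurable_const (measurable_pi_apply i)

/-- A monomial, extended by zero outside of the nonnegative orthant. -/
noncomputable def orthantMonomial (m : Fin n → ℕ) : (Fin n → ℝ) → ℝ :=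
  (orthant n).indicator fun x => ∏ i, x i ^ m i

theorem measurable_orthantMonomial (m : Fin n → ℕ) : Measurable (orthantMonomial m) :=
  Measurable.indicator (by fun_prop) (measurableSet_orthant n)

theorem orthantMonomial_smul (m : Fin n → ℕ) {t : ℝ} (ht : 0 < t) (x : Fin n → ℝ) :
    orthantMonomial m (t • x) = t ^ (∑ i, m i) * orthantMonomial m x := by
  have hiff : t • x ∈ orthant n ↔ x ∈ orthant n := by
    simp [orthant, mul_nonneg_iff_of_pos_left ht]
  unfold orthantMonomial
  by_cases hx : x ∈ orthant n
  · rw [Set.indicator_of_mem (hiff.2 hx), Set.indicator_of_mem hx]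
    simp [mul_pow, Finset.prod_mul_distrib, Finset.prod_pow_eq_pow_sum]
  · rw [Set.indicator_of_notMem (mt hiff.1 hx), Set.indicator_of_notMem hx, mul_zero]

theorem lintegral_orthantMonomial_mul_exp (m : Fin n → ℕ) :
    ∫⁻ x, ENNReal.ofReal (orthantMonomial m x * Real.exp (-∑ i, x i)) =
      ENNReal.ofReal (∏ i, ((m i).factorial : ℝ)) := by
  let f : Fin n → ℝ → ℝ := fun i =>
    (Set.Ici 0).indicator fun t => t ^ m i * Real.exp (-t)
  have hf : ∀ x : Fin n → ℝ, orthantMonomial m x * Real.exp (-∑ i, x i) = ∏ i, f i (x i) := by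
    intro x
    by_cases hx : x ∈ orthant n
    · rw [orthantMonomial, Set.indicator_of_mem hx, ← Finset.sum_neg_distrib, Real.exp_sum,
        ← Finset.prod_mul_distrib]
      exact Finset.prod_congr rfl fun i _ => (Set.indicator_of_mem (s := Set.Ici (0 : ℝ)) (hx i)
        fun t => t ^ m i * Real.exp (-t)).symm
    · rw [orthantMonomial, Set.indicator_of_notMem hx, zero_mul]
      simp only [orthant, Set.mem_ofPred_eq, not_forall] at hx
      obtain ⟨i, hi⟩ := hx
      exact (Finset.prod_eq_zero (Finset.mem_univ i) (Set.indicator_of_notMem hi _)).symm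
  have hint : ∀ i, Integrable (f i) := fun i => by
    rw [integrable_indicator_iff measurableSet_Ici, integrableOn_Ici_iff_integrableOn_Ioi]
    exact integrableOn_pow_mul_exp_neg _
  have hval : ∀ i, ∫ t, f i t = (m i).factorial := fun i => by
    rw [integral_indicator measurableSet_Ici, integral_Ici_eq_integral_Ioi,
      integral_pow_mul_exp_neg]
  have hnn : ∀ x : Fin n → ℝ, 0 ≤ ∏ i, f i (x i) := fun x =>
    Finset.prod_nonneg fun i _ => Set.indicator_nonneg
      (fun t (ht : 0 ≤ t) => mul_nonneg (pow_nonneg ht _) (Real.exp_nonneg _)) _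
  simp_rw [hf]
  rw [← ofReal_integral_eq_lintegral_ofReal (μ := volume) (Integrable.fintype_prod hint)
    (Filter.Eventually.of_forall hnn), integral_fintype_prod_volume_eq_prod]
  simp_rw [hval]

theorem lintegral_eq_mul_lintegral_comp_smul {f : (Fin n → ℝ) → ENNReal} (hf : Measurable f)
    {r : ℝ} (hr : 0 < r) : ∫⁻ x, f x = ENNReal.ofReal (r ^ n) * ∫⁻ y, f (r • y) := by
  have h := lintegral_map hf (measurable_const_smul r) (μ := (volume : Measure (Fin n → ℝ)))
  rw [Measure.map_addHaar_smul _ hr.ne', lintegral_smul_measure, Module.finrank_fin_fun,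
    abs_of_pos (by positivity), smul_eq_mul] at h
  rw [← h, ← mul_assoc, ← ENNReal.ofReal_mul (by positivity), mul_inv_cancel₀ (by positivity)]
  simp

/-- Write exp(-Σx) as the integral of exp(-t) over t ≥ Σx and exchange integrals. The slice Σx ≤ t
is a dilate of the simplex, so homogeneity leaves a Gamma integral in t. -/
theorem lintegral_orthantMonomial_mul_exp_eq (m : Fin n → ℕ) :
    ∫⁻ x, ENNReal.ofReal (orthantMonomial m x * Real.exp (-∑ i, x i)) =
      ENNReal.ofReal ((n + ∑ i, m i).factorial : ℝ) *
        ∫⁻ x in {x | ∑ i, x i ≤ 1}, ENNReal.ofReal (orthantMonomial m x) := by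
  have hg := measurable_orthantMonomial m
  have hS : Measurable fun x : Fin n → ℝ => ∑ i, x i := by fun_prop
  set J := ∫⁻ x in {x : Fin n → ℝ | ∑ i, x i ≤ 1}, ENNReal.ofReal (orthantMonomial m x) with hJ
  have hJ' : J = ∫⁻ x, ENNReal.ofReal (orthantMonomial m x) *
      (Set.Ici (∑ i, x i)).indicator (fun _ => 1) 1 := by
    rw [hJ, ← lintegral_indicator (measurableSet_le hS measurable_const)]
    refine lintegral_congr fun x => ?_
    by_cases hx : ∑ i, x i ≤ 1 <;> simp [hx]
  let Φ : (Fin n → ℝ) → ℝ → ENNReal := fun x t => ENNReal.ofReal (orthantMonomial m x) *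
    (Set.Ici (∑ i, x i)).indicator (fun t => ENNReal.ofReal (Real.exp (-t))) t
  have hind : Measurable fun p : (Fin n → ℝ) × ℝ =>
      (Set.Ici (∑ i, p.1 i)).indicator (fun t => ENNReal.ofReal (Real.exp (-t))) p.2 := by
    have e : (fun p : (Fin n → ℝ) × ℝ =>
        (Set.Ici (∑ i, p.1 i)).indicator (fun t => ENNReal.ofReal (Real.exp (-t))) p.2) =
        {p : (Fin n → ℝ) × ℝ | ∑ i, p.1 i ≤ p.2}.indicator
          fun p => ENNReal.ofReal (Real.exp (-p.2)) := by
      ext p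
      by_cases hp : ∑ i, p.1 i ≤ p.2 <;> simp [hp]
    rw [e]
    exact Measurable.indicator (by fun_prop)
      (measurableSet_le (hS.comp measurable_fst) measurable_snd)
  have hΦ : Measurable (Function.uncurry Φ) :=
    (hg.ennreal_ofReal.comp measurable_fst).mul hind
  have h1 : ∀ x, ENNReal.ofReal (orthantMonomial m x * Real.exp (-∑ i, x i)) = ∫⁻ t, Φ x t := by
    intro x
    rw [lintegral_const_mul _ (Measurable.indicator (by fun_prop) measurableSet_Ici),
      lintegral_indicator measurableSet_Ici, setLIntegral_congr Ioi_ae_eq_Ici.symm,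
      ← ofReal_integral_eq_lintegral_ofReal (integrableOn_exp_neg_Ioi _)
        (Filter.Eventually.of_forall fun t => Real.exp_nonneg _), integral_exp_neg_Ioi,
      ENNReal.ofReal_mul' (Real.exp_nonneg _)]
  simp_rw [h1]
  rw [lintegral_lintegral_swap hΦ.aemeasurable]
  have h2 : (fun t => ∫⁻ x, Φ x t) =ᵐ[volume] (Set.Ioi 0).indicator
      fun t => ENNReal.ofReal (t ^ (n + ∑ i, m i) * Real.exp (-t)) * J := by
    filter_upwards [compl_mem_ae_iff.2 (measure_singleton (0 : ℝ))] with t ht0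
    rcases lt_or_gt_of_ne ht0 with ht | ht
    · have : ∀ x, Φ x t = 0 := fun x => by
        by_cases hx : x ∈ orthant n
        · have : 0 ≤ ∑ i, x i := Finset.sum_nonneg fun i _ => hx i
          have : t ∉ Set.Ici (∑ i, x i) := by simp only [Set.mem_Ici]; linarith
          simp only [Φ]
          rw [Set.indicator_of_notMem this, mul_zero]
        · simp only [Φ]
          rw [orthantMonomial, Set.indicator_of_notMem hx, ENNReal.ofReal_zero, zero_mul]
      simp [this, ht.le]
    · have ht : 0 < t := ht
      rw [Set.indicator_of_mem (s := Set.Ioi (0 : ℝ)) ht,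
        lintegral_eq_mul_lintegral_comp_smul (by exact hΦ.comp (measurable_id.prodMk
          measurable_const)) ht, hJ']
      have h3 : ∀ y, Φ (t • y) t = ENNReal.ofReal (t ^ (∑ i, m i) * Real.exp (-t)) *
          (ENNReal.ofReal (orthantMonomial m y) *
            (Set.Ici (∑ i, y i)).indicator (fun _ => 1) 1) := fun y => by
        simp only [Φ]
        rw [orthantMonomial_smul m ht, ENNReal.ofReal_mul (by positivity),
          ENNReal.ofReal_mul (by positivity)]
        have e : ∑ i, (t • y) i = t * ∑ i, y i := by simp [Finset.mul_sum]
        rw [e]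
        by_cases hy : ∑ i, y i ≤ 1
        · rw [Set.indicator_of_mem (by simpa using mul_le_of_le_one_right ht.le hy),
            Set.indicator_of_mem (by simpa using hy), mul_one]
          ring
        · rw [Set.indicator_of_notMem (by
            simp only [Set.mem_Ici, not_le] at hy ⊢; nlinarith),
            Set.indicator_of_notMem (s := Set.Ici (∑ i, y i)) hy]
          simp
      simp_rw [h3]
      rw [lintegral_const_mul' _ _ ENNReal.ofReal_ne_top, ← mul_assoc,
        ← ENNReal.ofReal_mul (by positivity), pow_add, mul_assoc]
  rw [lintegral_congr_ae h2, lintegral_indicator measurableSet_Ioi,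
    lintegral_mul_const _ (by fun_prop),
    ← ofReal_integral_eq_lintegral_ofReal (integrableOn_pow_mul_exp_neg _)
      (ae_restrict_of_forall_mem measurableSet_Ioi fun t ht =>
        mul_nonneg (pow_nonneg (le_of_lt ht) _) (Real.exp_nonneg _)),
    integral_pow_mul_exp_neg]

/-- Dirichlet's formula for the integral of a monomial over the simplex. -/
theorem integral_simplex_prod_pow (m : Fin n → ℕ) :
    ∫ x in simplex n, ∏ i, x i ^ m i =
      (∏ i, ((m i).factorial : ℝ)) / ((n + ∑ i, m i).factorial : ℝ) := by
  have h := (lintegral_orthantMonomial_mul_exp m).symm.trans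
    (lintegral_orthantMonomial_mul_exp_eq m)
  have hS : MeasurableSet {x : Fin n → ℝ | ∑ i, x i ≤ 1} :=
    measurableSet_le (by fun_prop) measurable_const
  have hmp := PiLp.volume_preserving_toLp (Fin n)
  have hpre : (WithLp.toLp 2) ⁻¹' simplex n = orthant n ∩ {x : Fin n → ℝ | ∑ i, x i ≤ 1} := rfl
  have e : ∫ x in simplex n, ∏ i, x i ^ m i =
      ∫ x in orthant n ∩ {x : Fin n → ℝ | ∑ i, x i ≤ 1}, ∏ i, x i ^ m i := by
    rw [← hpre]
    exact (hmp.setIntegral_preimage_emb (MeasurableEquiv.toLp 2 (Fin n → ℝ)).measurableEmbedding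
      (fun x : E n => ∏ i, x i ^ m i) (simplex n)).symm
  have e2 : ∫⁻ x in {x : Fin n → ℝ | ∑ i, x i ≤ 1}, ENNReal.ofReal (orthantMonomial m x) =
      ∫⁻ x in orthant n ∩ {x : Fin n → ℝ | ∑ i, x i ≤ 1}, ENNReal.ofReal (∏ i, x i ^ m i) := by
    rw [← Measure.restrict_restrict (measurableSet_orthant n),
      ← lintegral_indicator (measurableSet_orthant n)]
    refine lintegral_congr fun x => ?_
    by_cases hx : x ∈ orthant n <;> simp [orthantMonomial, hx]
  rw [e, integral_eq_lintegral_of_nonneg_ae (ae_restrict_of_forall_mem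
    ((measurableSet_orthant n).inter hS) fun x hx => Finset.prod_nonneg fun i _ =>
      pow_nonneg (hx.1 i) _) (Measurable.aestronglyMeasurable (by fun_prop)), ← e2]
  have h2 := congrArg ENNReal.toReal h
  rw [ENNReal.toReal_mul, ENNReal.toReal_ofReal (by positivity),
    ENNReal.toReal_ofReal (by positivity)] at h2
  rw [eq_div_iff (by positivity), h2, mul_comm]

theorem volumeReal_simplex (n : ℕ) : volume.real (simplex n) = (n.factorial : ℝ)⁻¹ := by
  have h := integral_simplex_prod_pow (n := n) 0
  simpa using h

theorem integral_simplex_coord (i : Fin n) :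
    ∫ x in simplex n, x i = ((n + 1).factorial : ℝ)⁻¹ := by
  have h := integral_simplex_prod_pow (n := n) (Pi.single i 1)
  have h1 : ∀ x : E n, ∏ j, x j ^ (Pi.single i 1 : Fin n → ℕ) j = x i := fun x => by
    rw [Finset.prod_eq_single i (fun j _ hj => by simp [hj]) (by simp)]
    simp
  have h2 : ∏ j, (((Pi.single i 1 : Fin n → ℕ) j).factorial : ℝ) = 1 :=
    Finset.prod_eq_one fun j _ => by
      rcases eq_or_ne j i with rfl | hj
      · simp
      · simp [hj]
  simp_rw [h1, h2] at h
  simpa using h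

theorem integral_simplex_coord_mul (i j : Fin n) :
    ∫ x in simplex n, x i * x j = (if i = j then 2 else 1) * ((n + 2).factorial : ℝ)⁻¹ := by
  have h := integral_simplex_prod_pow (n := n) (Pi.single i 1 + Pi.single j 1)
  have h1 : ∀ (i : Fin n) (x : E n), ∏ k, x k ^ (Pi.single i 1 : Fin n → ℕ) k = x i :=
    fun i x => by
      rw [Finset.prod_eq_single i (fun j _ hj => by simp [hj]) (by simp)]
      simp
  have h2 : ∏ k, (((Pi.single i 1 + Pi.single j 1 : Fin n → ℕ) k).factorial : ℝ) =
      if i = j then 2 else 1 := by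
    split_ifs with hij
    · subst hij
      rw [Finset.prod_eq_single i (fun j _ hj => by simp [hj]) (by simp)]
      simp
    · refine Finset.prod_eq_one fun k _ => ?_
      rcases eq_or_ne k i with rfl | hk
      · simp [hij]
      · rcases eq_or_ne k j with rfl | hk'
        · simp [hk]
        · simp [hk, hk']
  simp_rw [Pi.add_apply, pow_add, Finset.prod_mul_distrib, h1] at h
  rw [h]
  simp only [Pi.add_apply] at h2
  rw [h2, div_eq_mul_inv]
  simp [Finset.sum_add_distrib]

/-! ### The isotropic constant of the simplex -/

/-- Written as a rank-one perturbation of the identity so that the matrix determinant lemma applies.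
-/
theorem covMatrix_simplex (n : ℕ) : covMatrix (simplex n) =
    (((n : ℝ) + 1) * (n + 2))⁻¹ • (1 + Matrix.replicateCol Unit (fun _ : Fin n => (1 : ℝ)) *
      Matrix.replicateRow Unit fun _ : Fin n => -((n : ℝ) + 1)⁻¹) := by
  have h1 : ((n + 1).factorial : ℝ) = (n + 1) * n.factorial := by
    rw [Nat.factorial_succ]; push_cast; ring
  have h2 : ((n + 2).factorial : ℝ) = (n + 2) * ((n + 1) * n.factorial) := by
    rw [Nat.factorial_succ, Nat.cast_mul, h1]; push_cast; ring
  have h0 : (n.factorial : ℝ) ≠ 0 := by positivity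
  have h3 : (n : ℝ) + 1 ≠ 0 := by positivity
  have h4 : (n : ℝ) + 2 ≠ 0 := by positivity
  ext i j
  simp only [covMatrix, Matrix.of_apply, integral_simplex_coord, integral_simplex_coord_mul,
    volumeReal_simplex, h1, h2, Matrix.smul_apply, Matrix.add_apply, Matrix.one_apply,
    Matrix.mul_apply, Matrix.replicateCol_apply, Matrix.replicateRow_apply, smul_eq_mul,
    Finset.univ_unique, Finset.sum_singleton]
  split_ifs <;> field_simp <;> ring

theorem det_covMatrix_simplex (n : ℕ) :
    (covMatrix (simplex n)).det = (((n : ℝ) + 1) ^ (n + 1) * ((n : ℝ) + 2) ^ n)⁻¹ := by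
  have h3 : (n : ℝ) + 1 ≠ 0 := by positivity
  rw [covMatrix_simplex, Matrix.det_smul, Matrix.det_one_add_replicateCol_mul_replicateRow]
  simp only [dotProduct, Fintype.card_fin, Finset.sum_const, Finset.card_univ, nsmul_eq_mul,
    mul_one]
  rw [inv_pow, mul_pow, pow_succ]
  field_simp
  ring

theorem isotropicConstant_pow (hn : 1 ≤ n) {K : Set (E n)} (hK : IsConvexBody K) :
    isotropicConstant K ^ (2 * n) = (covMatrix K).det / volume.real K ^ 2 := by
  have h : 0 ≤ (covMatrix K).det / volume.real K ^ 2 :=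
    div_nonneg (det_covMatrix_nonneg hK) (sq_nonneg _)
  have e : 1 / (2 * (n : ℝ)) = ((2 * n : ℕ) : ℝ)⁻¹ := by push_cast; rw [one_div]
  rw [isotropicConstant, e, Real.rpow_inv_natCast_pow h (by omega)]

theorem isotropicConstant_nonneg {K : Set (E n)} (hK : IsConvexBody K) :
    0 ≤ isotropicConstant K :=
  Real.rpow_nonneg (div_nonneg (det_covMatrix_nonneg hK) (sq_nonneg _)) _

theorem isotropicConstant_simplex_pow (hn : 1 ≤ n) :
    isotropicConstant (simplex n) ^ (2 * n) =
      (n.factorial : ℝ) ^ 2 / (((n : ℝ) + 1) ^ (n + 1) * ((n : ℝ) + 2) ^ n) := by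
  rw [isotropicConstant_pow hn (isConvexBody_simplex n), det_covMatrix_simplex,
    volumeReal_simplex]
  field_simp

theorem isotropicConstant_simplex (hn : 1 ≤ n) :
    isotropicConstant (simplex n) = (n.factorial : ℝ) ^ (1 / (n : ℝ)) /
      (((n : ℝ) + 1) ^ (((n : ℝ) + 1) / (2 * (n : ℝ))) * Real.sqrt ((n : ℝ) + 2)) := by
  have hn0 : (n : ℝ) ≠ 0 := by positivity
  refine (pow_left_inj₀ (isotropicConstant_nonneg (isConvexBody_simplex n)) (by positivity)
    (show 2 * n ≠ 0 by omega)).1 ?_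
  rw [isotropicConstant_simplex_pow hn, div_pow, mul_pow]
  congr 1
  · rw [← Real.rpow_natCast, ← Real.rpow_natCast, ← Real.rpow_mul (by positivity)]
    congr 1
    push_cast
    field_simp
  · congr 1
    · rw [← Real.rpow_natCast, ← Real.rpow_natCast, ← Real.rpow_mul (by positivity)]
      congr 1
      push_cast
      field_simp
    · rw [pow_mul, Real.sq_sqrt (by positivity)]

/-! ### The volume product of the simplex -/

theorem pos_of_mem_interior_simplex (hn : 1 ≤ n) {z : E n} (hz : z ∈ interior (simplex n)) :
    (∀ i, 0 < z i) ∧ ∑ i, z i < 1 := by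
  obtain ⟨r, hr, hball⟩ := Metric.isOpen_iff.1 isOpen_interior z hz
  have hmem : ∀ (i : Fin n) (s : ℝ), |s| < r →
      z + EuclideanSpace.single i s ∈ simplex n := fun i s hs =>
    interior_subset (hball (by simpa [dist_eq_norm] using hs))
  constructor
  · intro i
    have h := (hmem i (-(r / 2)) (by rw [abs_neg, abs_of_pos (by positivity)]; linarith)).1 i
    simp only [PiLp.add_apply, PiLp.single_apply, if_true] at h
    linarith
  · have h := (hmem ⟨0, hn⟩ (r / 2) (by rw [abs_of_pos (by positivity)]; linarith)).2
    simp only [PiLp.add_apply, PiLp.single_apply, Finset.sum_add_distrib,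
      Finset.sum_ite_eq', Finset.mem_univ, if_true] at h
    linarith

/-- The matrix of the affine map identifying a polar of the simplex with the simplex. -/
noncomputable def polarMatrix (z : E n) : Matrix (Fin n) (Fin n) ℝ :=
  Matrix.diagonal z * -(1 + Matrix.replicateCol Unit (fun _ : Fin n => (1 : ℝ)) *
    Matrix.replicateRow Unit fun i : Fin n => -z i)

theorem polarMatrix_apply (z : E n) (i j : Fin n) :
    polarMatrix z i j = z i * (z j - if i = j then 1 else 0) := by
  rw [polarMatrix, Matrix.diagonal_mul]
  simp only [Matrix.neg_apply, Matrix.add_apply,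
    Matrix.one_apply, Matrix.mul_apply, Matrix.replicateCol_apply, Matrix.replicateRow_apply,
    Finset.univ_unique, Finset.sum_singleton]
  ring

theorem abs_det_polarMatrix {z : E n} (hz : ∀ i, 0 < z i) (hz1 : ∑ i, z i < 1) :
    |(polarMatrix z).det| = (∏ i, z i) * (1 - ∑ i, z i) := by
  rw [polarMatrix, Matrix.det_mul, Matrix.det_diagonal, Matrix.det_neg,
    Matrix.det_one_add_replicateCol_mul_replicateRow, abs_mul, abs_mul, abs_pow, abs_neg, abs_one,
    one_pow, one_mul, abs_of_pos (Finset.prod_pos fun i _ => hz i)]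
  simp only [dotProduct, mul_one, Finset.sum_neg_distrib, ← sub_eq_add_neg]
  rw [abs_of_pos (by linarith)]

/-- The polar is cut out by the `n + 1` inequalities at the vertices. In the coordinates z_i (1 +
⟨z,w⟩ - w_i) they become the inequalities defining the simplex. -/
theorem polar_simplex_eq_preimage {z : E n} (hz : ∀ i, 0 < z i) (hz1 : ∑ i, z i < 1) :
    polar ((fun x => x - z) '' simplex n) =
      (Matrix.toLin (EuclideanSpace.basisFun (Fin n) ℝ).toBasis
        (EuclideanSpace.basisFun (Fin n) ℝ).toBasis (polarMatrix z)) ⁻¹'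
        ((fun x => x + z) ⁻¹' simplex n) := by
  ext w
  have hinner : ∀ x : E n, inner ℝ x w = ∑ i, x i * w i := fun x => by
    simp [PiLp.inner_apply, mul_comm]
  have hcoord : ∀ i, (Matrix.toLin (EuclideanSpace.basisFun (Fin n) ℝ).toBasis
      (EuclideanSpace.basisFun (Fin n) ℝ).toBasis (polarMatrix z) w + z) i =
      z i * (1 + inner ℝ z w - w i) := fun i => by
    have h1 : Matrix.toLin (EuclideanSpace.basisFun (Fin n) ℝ).toBasis
        (EuclideanSpace.basisFun (Fin n) ℝ).toBasis (polarMatrix z) w i =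
        ∑ j, polarMatrix z i j * w j := by
      rw [Matrix.toLin_apply]
      simp [Matrix.mulVec, dotProduct, Pi.single_apply]
    rw [PiLp.add_apply, h1, hinner]
    simp only [polarMatrix_apply, mul_sub, sub_mul, Finset.sum_sub_distrib, mul_ite, ite_mul,
      mul_one, mul_zero, zero_mul, Finset.sum_ite_eq, Finset.mem_univ, if_true, mul_assoc,
      ← Finset.mul_sum]
    ring
  have hleft : w ∈ polar ((fun x => x - z) '' simplex n) ↔
      ∀ i, inner ℝ (simplexVertex n i - z) w ≤ 1 := by
    refine ⟨fun h i => h _ ⟨_, simplexVertex_mem i, rfl⟩, fun h => ?_⟩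
    rintro _ ⟨x, hx, rfl⟩
    have hconv : Convex ℝ {x : E n | inner ℝ (x - z) w ≤ 1} := by
      intro x hx y hy a b ha hb hab
      simp only [Set.mem_ofPred_eq, inner_sub_left, inner_add_left, real_inner_smul_left] at hx hy ⊢
      obtain rfl : a = 1 - b := by linarith
      nlinarith
    exact simplex_subset_of_convex hconv h hx
  have hsum : ∑ i, z i * (1 + inner ℝ z w - w i) =
      (∑ i, z i) * (1 + inner ℝ z w) - inner ℝ z w := by
    rw [Finset.sum_mul]
    conv_rhs => rw [hinner z]
    rw [← Finset.sum_sub_distrib, ← hinner]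
    exact Finset.sum_congr rfl fun i _ => by ring
  rw [hleft, Fin.forall_fin_succ]
  simp only [Set.mem_preimage, simplex, Set.mem_ofPred_eq, hcoord, hsum]
  -- Both sides say 1 + ⟨z,w⟩ ≥ 0; the right one carries the positive factor 1 - Σ z_i.
  have h0 : inner ℝ (simplexVertex n 0 - z) w ≤ 1 ↔
      (∑ i, z i) * (1 + inner ℝ z w) - inner ℝ z w ≤ 1 := by
    simp only [simplexVertex, Fin.cons_zero, zero_sub, inner_neg_left]
    constructor
    · intro h; nlinarith
    · intro h
      by_contra! h'
      nlinarith
  have hs : ∀ i : Fin n, inner ℝ (simplexVertex n i.succ - z) w ≤ 1 ↔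
      0 ≤ z i * (1 + inner ℝ z w - w i) := fun i => by
    have : inner ℝ (simplexVertex n i.succ) w = w i := by
      simp [simplexVertex, EuclideanSpace.inner_single_left]
    rw [inner_sub_left, this, mul_nonneg_iff_of_pos_left (hz i)]
    constructor <;> intro h <;> linarith
  rw [h0, and_comm]
  simp only [hs]

theorem volumeProductAt_simplex {z : E n} (hz : ∀ i, 0 < z i) (hz1 : ∑ i, z i < 1) :
    (volumeProductAt (simplex n) z).toReal =
      ((n.factorial : ℝ) ^ 2 * ((∏ i, z i) * (1 - ∑ i, z i)))⁻¹ := by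
  have hdet := abs_det_polarMatrix hz hz1
  have hpos : 0 < (∏ i, z i) * (1 - ∑ i, z i) :=
    mul_pos (Finset.prod_pos fun i _ => hz i) (by linarith)
  have hne : LinearMap.det (Matrix.toLin (EuclideanSpace.basisFun (Fin n) ℝ).toBasis
      (EuclideanSpace.basisFun (Fin n) ℝ).toBasis (polarMatrix z)) ≠ 0 := by
    rw [LinearMap.det_toLin, ← abs_pos, hdet]
    exact hpos
  rw [volumeProductAt, volume_polarAt, polar_simplex_eq_preimage hz hz1,
    Measure.addHaar_preimage_linearMap _ hne, measure_preimage_add_right, LinearMap.det_toLin,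
    ENNReal.toReal_mul, ENNReal.toReal_mul, ENNReal.toReal_ofReal (abs_nonneg _), abs_inv, hdet,
    ← Measure.real, volumeReal_simplex]
  generalize (∏ i, z i) * (1 - ∑ i, z i) = q
  rw [mul_inv, sq, mul_inv]
  ring

/-- The AM-GM inequality for barycentric coordinates. -/
theorem prod_mul_one_sub_sum_le {z : Fin n → ℝ} (hz : ∀ i, 0 ≤ z i) (hz1 : ∑ i, z i ≤ 1) :
    (∏ i, z i) * (1 - ∑ i, z i) ≤ (((n : ℝ) + 1) ^ (n + 1))⁻¹ := by
  let w : Fin (n + 1) → ℝ := Fin.cons (1 - ∑ i, z i) z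
  have hw : ∀ i, 0 ≤ w i := fun i => by
    refine Fin.cases ?_ (fun j => ?_) i
    · simpa [w] using hz1
    · simpa [w] using hz j
  have hprod : ∏ i, w i = (∏ i, z i) * (1 - ∑ i, z i) := by
    simp [w, Fin.prod_univ_succ, mul_comm]
  have hsum : ∑ i, w i = 1 := by simp [w, Fin.sum_univ_succ]
  have h := Real.geom_mean_le_arith_mean_weighted Finset.univ
    (fun _ : Fin (n + 1) => (((n + 1 : ℕ) : ℝ))⁻¹) w (fun _ _ => by positivity)
    (by simp only [Finset.sum_const, Finset.card_univ, Fintype.card_fin, nsmul_eq_mul]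
        exact mul_inv_cancel₀ (by positivity)) fun i _ => hw i
  rw [← Finset.mul_sum, hsum, mul_one] at h
  have h2 := pow_le_pow_left₀ (Finset.prod_nonneg fun i _ => Real.rpow_nonneg (hw i) _) h (n + 1)
  rw [← Finset.prod_pow] at h2
  simp_rw [fun i => Real.rpow_inv_natCast_pow (hw i) (Nat.succ_ne_zero n)] at h2
  rw [hprod, inv_pow] at h2
  exact_mod_cast h2

theorem volumeProduct_simplex (hn : 1 ≤ n) :
    volumeProduct (simplex n) = ((n : ℝ) + 1) ^ (n + 1) / (n.factorial : ℝ) ^ 2 := by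
  have hn1 : (0 : ℝ) < (n : ℝ) + 1 := by positivity
  apply le_antisymm
  · refine (volumeProduct_le (centroid_mem_interior_simplex n)).trans_eq ?_
    obtain ⟨h1, h2⟩ := pos_of_mem_interior_simplex hn (centroid_mem_interior_simplex n)
    rw [volumeProductAt_simplex h1 h2]
    simp only [Finset.prod_const, Finset.sum_const, Finset.card_univ, Fintype.card_fin,
      nsmul_eq_mul]
    have : 1 - (n : ℝ) * ((n : ℝ) + 1)⁻¹ = ((n : ℝ) + 1)⁻¹ := by field_simp; ring
    rw [this, ← pow_succ, inv_pow, mul_inv, inv_inv, div_eq_mul_inv, mul_comm]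
  · obtain ⟨z, hz, h⟩ := exists_volumeProduct_eq (isConvexBody_simplex n)
    obtain ⟨h1, h2⟩ := pos_of_mem_interior_simplex hn hz
    rw [h, volumeProductAt_simplex h1 h2]
    have h3 := prod_mul_one_sub_sum_le (fun i => (h1 i).le) h2.le
    have hpos : 0 < (∏ i, z i) * (1 - ∑ i, z i) :=
      mul_pos (Finset.prod_pos fun i _ => h1 i) (by linarith)
    rw [mul_inv, div_eq_mul_inv, mul_comm]
    refine mul_le_mul_of_nonneg_left ?_ (inv_nonneg.2 (sq_nonneg _))
    exact (le_inv_comm₀ (pow_pos hn1 _) hpos).2 h3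

/-! ### From slicing to Mahler -/

/-- A minimizer of the volume product centred at the origin: strong slicing forces the Mahler bound,
and equality forces the extremal isotropic constant. -/
theorem StrongSlicing.le_of_isMin (hn : 1 ≤ n) (hs : StrongSlicing n) {K : Set (E n)}
    (hK : IsConvexBody K) (h0 : (0 : E n) ∈ interior K)
    (hmin : ∀ (L : Set (E n)) (w : E n), IsConvexBody L →
      volumeProductAt K 0 ≤ volumeProductAt L w) :
    volumeProduct (simplex n) ≤ (volumeProductAt K 0).toReal ∧
      ((volumeProductAt K 0).toReal = volumeProduct (simplex n) →
        isotropicConstant K = isotropicConstant (simplex n)) := by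
  have hL := hK.polar h0
  have hvK := hK.volumeReal_pos
  have hvL := hL.volumeReal_pos
  set Λ := isotropicConstant (simplex n) with hΛ
  set a := isotropicConstant K with ha
  set b := isotropicConstant (polar K) with hb
  have ha0 : 0 ≤ a := isotropicConstant_nonneg hK
  have hb0 : 0 ≤ b := isotropicConstant_nonneg hL
  have haΛ : a ≤ Λ := hs K hK
  have hbΛ : b ≤ Λ := hs _ hL
  have hP : (volumeProductAt K 0).toReal = volume.real K * volume.real (polar K) := by
    rw [volumeProductAt, polarAt_zero, ENNReal.toReal_mul]; rfl
  set P := (volumeProductAt K 0).toReal with hPdef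
  have hP0 : 0 < P := hP ▸ mul_pos hvK hvL
  have hdet := inv_pow_le_det_covMatrix_mul hK h0 hmin
  have e1 : (covMatrix K).det = a ^ (2 * n) * volume.real K ^ 2 := by
    rw [ha, isotropicConstant_pow hn hK]; field_simp
  have e2 : (covMatrix (polar K)).det = b ^ (2 * n) * volume.real (polar K) ^ 2 := by
    rw [hb, isotropicConstant_pow hn hL]; field_simp
  have hkey : (((n : ℝ) + 2)⁻¹ ^ 2) ^ n ≤ a ^ (2 * n) * b ^ (2 * n) * P ^ 2 := by
    rw [hP]
    refine hdet.trans_eq ?_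
    rw [e1, e2]
    ring
  -- The simplex turns the covariance inequality into an equality, which is why the constants match
  -- exactly.
  have hΛpow : Λ ^ (2 * n) * volumeProduct (simplex n) = (((n : ℝ) + 2)⁻¹) ^ n := by
    rw [hΛ, isotropicConstant_simplex_pow hn, volumeProduct_simplex hn, inv_pow]
    field_simp
  have hMpos : 0 < volumeProduct (simplex n) := by
    rw [volumeProduct_simplex hn]; positivity
  have hΛ0 : 0 < Λ := by
    refine lt_of_le_of_ne (ha0.trans haΛ) fun h => ?_
    rw [← h, zero_pow (by omega), zero_mul] at hΛpow
    have : (0 : ℝ) < (((n : ℝ) + 2)⁻¹) ^ n := by positivity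
    linarith
  have hsq : (Λ ^ (2 * n) * volumeProduct (simplex n)) ^ 2 ≤ a ^ (2 * n) * b ^ (2 * n) * P ^ 2 := by
    rw [hΛpow, ← pow_mul, mul_comm n 2, pow_mul]
    exact hkey
  have hap : a ^ (2 * n) ≤ Λ ^ (2 * n) := pow_le_pow_left₀ ha0 haΛ _
  have hbp : b ^ (2 * n) ≤ Λ ^ (2 * n) := pow_le_pow_left₀ hb0 hbΛ _
  have hΛp : 0 < Λ ^ (2 * n) := pow_pos hΛ0 _
  constructor
  · have h1 : (Λ ^ (2 * n) * volumeProduct (simplex n)) ^ 2 ≤ (Λ ^ (2 * n) * P) ^ 2 :=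
      hsq.trans (by
        rw [mul_pow, sq (Λ ^ (2 * n))]
        gcongr)
    exact le_of_mul_le_mul_left ((pow_le_pow_iff_left₀ (by positivity) (by positivity)
      two_ne_zero).1 h1) hΛp
  · intro hPeq
    rw [← hPeq] at hsq
    -- Bounding only the polar's constant by `Λ` leaves the reverse inequality for that of `K`.
    have h1 : Λ ^ (2 * n) * Λ ^ (2 * n) ≤ a ^ (2 * n) * Λ ^ (2 * n) := by
      refine le_of_mul_le_mul_right (a := P ^ 2) ?_ (by positivity)
      calc Λ ^ (2 * n) * Λ ^ (2 * n) * P ^ 2 = (Λ ^ (2 * n) * P) ^ 2 := by ring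
        _ ≤ a ^ (2 * n) * b ^ (2 * n) * P ^ 2 := hsq
        _ ≤ a ^ (2 * n) * Λ ^ (2 * n) * P ^ 2 := by gcongr
    have h2 := le_of_mul_le_mul_right h1 hΛp
    exact le_antisymm haΛ ((pow_le_pow_iff_left₀ hΛ0.le ha0 (by omega)).1 h2)

theorem volumeProductAt_translate (K : Set (E n)) (z : E n) :
    volumeProductAt (affImage (ContinuousLinearEquiv.refl ℝ (E n)) (-z) K) 0 =
      volumeProductAt K z := by
  rw [← volumeProductAt_affImage (ContinuousLinearEquiv.refl ℝ (E n)) (-z) K z]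
  simp

theorem zero_mem_interior_translate {K : Set (E n)} {z : E n} (hz : z ∈ interior K) :
    (0 : E n) ∈ interior (affImage (ContinuousLinearEquiv.refl ℝ (E n)) (-z) K) := by
  rw [interior_affImage]
  exact ⟨z, hz, by simp⟩

theorem StrongSlicing.volumeProduct_simplex_le_volumeProductAt (hn : 1 ≤ n) (hs : StrongSlicing n)
    {L : Set (E n)} (hL : IsConvexBody L) (w : E n) :
    ENNReal.ofReal (volumeProduct (simplex n)) ≤ volumeProductAt L w := by
  obtain ⟨K, z, hK, hz, hmin⟩ := exists_forall_volumeProductAt_le n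
  have h := (hs.le_of_isMin hn (hK.affImage (ContinuousLinearEquiv.refl ℝ (E n)) (-z))
    (zero_mem_interior_translate hz) fun L w hL => by
      rw [volumeProductAt_translate]; exact hmin L w hL).1
  rw [volumeProductAt_translate] at h
  exact (ENNReal.ofReal_le_of_le_toReal h).trans (hmin L w hL)

theorem StrongSlicing.volumeProduct_simplex_le (hn : 1 ≤ n) (hs : StrongSlicing n)
    {K : Set (E n)} (hK : IsConvexBody K) : volumeProduct (simplex n) ≤ volumeProduct K := by
  obtain ⟨z, hz, h⟩ := exists_volumeProduct_eq hK
  rw [h]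
  exact (ENNReal.ofReal_le_iff_le_toReal (volumeProductAt_lt_top hK hz).ne).1
    (hs.volumeProduct_simplex_le_volumeProductAt hn hK z)

/-- By the Mahler bound, a body attaining equality is itself a global minimizer, so the equality
clause of `StrongSlicing.le_of_isMin` applies to it once its optimal base point is moved to the
origin. -/
theorem StrongSlicing.isSimplex_of_volumeProduct_eq (hn : 1 ≤ n) (hs : StrongSlicing n)
    (huniq : ∀ K : Set (E n), IsConvexBody K →
      isotropicConstant K = isotropicConstant (simplex n) → IsSimplex K)
    {K : Set (E n)} (hK : IsConvexBody K) (hP : volumeProduct K = volumeProduct (simplex n)) :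
    IsSimplex K := by
  obtain ⟨z, hz, h⟩ := exists_volumeProduct_eq hK
  have hK' := hK.affImage (ContinuousLinearEquiv.refl ℝ (E n)) (-z)
  have hiso := (hs.le_of_isMin hn hK' (zero_mem_interior_translate hz) fun L w hL => by
    rw [volumeProductAt_translate, ← ENNReal.ofReal_toReal (volumeProductAt_lt_top hK hz).ne, ← h,
      hP]
    exact hs.volumeProduct_simplex_le_volumeProductAt hn hL w).2
      (by rw [volumeProductAt_translate, ← h, hP])
  have hsimp := (huniq _ hK' hiso).affImage (ContinuousLinearEquiv.refl ℝ (E n)) z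
  have e : affImage (ContinuousLinearEquiv.refl ℝ (E n)) z
      (affImage (ContinuousLinearEquiv.refl ℝ (E n)) (-z) K) = K := by
    rw [affImage, affImage, Set.image_image]
    simp
  rwa [e] at hsimp

end SlicingMahler

theorem mainTheorem10 (n : ℕ) (hn : 1 ≤ n) :
    SlicingMahler.isotropicConstant (SlicingMahler.simplex n) =
        (n.factorial : ℝ) ^ (1 / (n : ℝ)) /
          (((n : ℝ) + 1) ^ (((n : ℝ) + 1) / (2 * (n : ℝ))) * Real.sqrt ((n : ℝ) + 2)) ∧
    SlicingMahler.volumeProduct (SlicingMahler.simplex n) =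
        ((n : ℝ) + 1) ^ (n + 1) / (n.factorial : ℝ) ^ 2 ∧
    (∀ K : Set (SlicingMahler.E n), SlicingMahler.IsSimplex K →
      SlicingMahler.volumeProduct K =
        SlicingMahler.volumeProduct (SlicingMahler.simplex n)) ∧
    (SlicingMahler.StrongSlicing n →
      (∀ K : Set (SlicingMahler.E n), SlicingMahler.IsConvexBody K →
        SlicingMahler.volumeProduct (SlicingMahler.simplex n) ≤
          SlicingMahler.volumeProduct K) ∧
      ((∀ K : Set (SlicingMahler.E n), SlicingMahler.IsConvexBody K →
          SlicingMahler.isotropicConstant K =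
            SlicingMahler.isotropicConstant (SlicingMahler.simplex n) →
          SlicingMahler.IsSimplex K) →
        ∀ K : Set (SlicingMahler.E n), SlicingMahler.IsConvexBody K →
          SlicingMahler.volumeProduct K =
            SlicingMahler.volumeProduct (SlicingMahler.simplex n) →
          SlicingMahler.IsSimplex K)) := by
  refine ⟨SlicingMahler.isotropicConstant_simplex hn, SlicingMahler.volumeProduct_simplex hn,
    fun K hK => ?_, fun hs => ⟨fun K hK => hs.volumeProduct_simplex_le hn hK,
      fun huniq K hK hP => hs.isSimplex_of_volumeProduct_eq hn huniq hK hP⟩⟩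
  obtain ⟨A, v, rfl⟩ := hK.exists_affImage
  exact SlicingMahler.volumeProduct_affImage A v _
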